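/- **Theorem (completeness for Cartesian closed categories).** Let $\Sigma$ be a set of base types. *Terms.* Types of the sequential $\lambda$-calculus are $t ::= \alpha \mid (\vec s > \vec t\,)$ with $\alpha\in\Sigma$ and $\vec s,\vec t$ finite vectors of types (types of the input and the output stack). Write $\overleftarrow{s}$ for the reversal of $\vec s$ and $\varepsilon$ for the empty vector. Typed terms $\Gamma\vdash M:t$, taken up to renaming of bound variables, are generated by the rules: $\Gamma, x:\alpha\vdash x:\alpha$; $\;\Gamma\vdash *:\overleftarrow{t}>\vec t$; $\;\Gamma\vdash x.M:\overleftarrow{r}\,\overleftarrow{t}>\vec u$ if $(x:\overleftarrow{r}>\vec s)\in\Gamma$ and $\Gamma\vdash M:\overleftarrow{s}\,\overleftarrow{t}>\vec u$; $\;\Gamma\vdash [N].M:\overleftarrow{s}>\vec t$ if $\Gamma\vdash N:r$ and $\Gamma\vdash M:r\,\overleftarrow{s}>\vec t$; $\;\Gamma\vdash\langle x\rangle.M:r\,\overleftarrow{s}>\vec t$ if $\Gamma,x:r\vdash M:\overleftarrow{s}>\vec t$. Composition $N;M$ (also written $N.M$) substitutes $M$ for the final $*$ of $N$ without capture, and substitution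 satisfies $\{P/x\}(x.M)=P;\{P/x\}M$. *Equations.* $=_{\mathsf{eqn}}$ is the least family of equivalence relations on the terms of each context and type that is closed under all contexts and contains - $[N].\langle x\rangle.M = \{N/x\}M$, - $\langle\overleftarrow{x}\rangle.N.[\vec x].M = M.\langle\overleftarrow{y}\rangle.N.[\vec y]$, - $M.\langle\overleftarrow{y}\rangle.[\vec y].[\vec y] = \langle\overleftarrow{x}\rangle.[\vec x].M.[\vec x].M$, - $M.\langle\overleftarrow{y}\rangle=\langle\overleftarrow{x}\rangle$, - $*=\langle a\rangle.[a]:\alpha>\alpha$ for $\alpha\in\Sigma$, - $P=\langle\overleftarrow{x}\rangle.[[\vec x].P.\langle z\rangle.z]$ for $P:\overleftarrow{r}>(\overleftarrow{s}>\vec t\,)$, where $M:\overleftarrow{s}>\vec t$ and $N:\overleftarrow{r}>\vec u$ in the second to fourth laws, the vectors $\vec x,\vec y$ have the matching input and output types, and no displayed abstraction captures a variable of $M$, $N$ or $P$ (except $x$ in $M$ in the first law). Let $\mathcal S(\Sigma)$ be the category whose objects are type vectors and whose morphisms $\vec s\to\vec t$ are the closed terms $\overleftarrow{s}>\vec t$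 modulo $=_{\mathsf{eqn}}$, with composition $N;M$ and identity $*$. *Claim.* Let $\mathsf{CCC}(\Sigma)$ be the free Cartesian closed category on $\Sigma$. Interpret each $\alpha\in\Sigma$ by the one-element vector $\alpha$, the terminal object by $\varepsilon$, products by concatenation and exponentials by $\overleftarrow{s}>\vec t$; and interpret the maps to the terminal object by $\langle\overleftarrow{x}\rangle$, the projections by $\langle\overleftarrow{x}\rangle.\langle\overleftarrow{y}\rangle.[\vec y]$ and $\langle\overleftarrow{x}\rangle.\langle\overleftarrow{y}\rangle.[\vec x]$, the pairing of $N$ and $M$ by $\langle\overleftarrow{x}\rangle.[\vec x].N.[\vec x].M$, evaluation by $\langle z\rangle.z$, and currying of $M$ by $\langle\overleftarrow{x}\rangle.[[\vec x].M]$. This respects the equations of Cartesian closed categories, so it induces a canonical functor $\mathsf{CCC}(\Sigma)\to\mathcal S(\Sigma)$; and this functor is faithful. That is, typed terms modulo $=_{\mathsf{eqn}}$ form a complete language for Cartesian closed categories. -/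

import Mathlib

open CategoryTheory

universe u

namespace FMC

/-! # The simply typed sequential lambda-calculus

Stacks (and stack types) are lists whose head is the top of the stack.  A stack type that is
written `t₁ … tₙ` on the output side of an arrow, or `tₙ … t₁` on its input side, is the list
`[tₙ, …, t₁]`. -/

/-- Types over the base types `S`: base types, and arrows `a > b` from an input stack type to an
output stack type. -/
inductive Ty (S : Type u) : Type u
  | base : S → Ty S
  | arr : List (Ty S) → List (Ty S) → Ty S

/-- Stack types (type vectors), head on top. -/
abbrev Stk (S : Type u) := List (Ty S)

/-- Contexts, the most recently bound variable first. -/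
abbrev Ctx (S : Type u) := List (Ty S)

variable {S : Type u}

/-- Variables of type `t` in a context (typed de Bruijn indices). -/
inductive Var : Ctx S → Ty S → Type u
  | zero {Γ : Ctx S} {t : Ty S} : Var (t :: Γ) t
  | succ {Γ : Ctx S} {t r : Ty S} : Var Γ t → Var (r :: Γ) t

/-- Typed terms, i.e. judgements `Γ ⊢ M : t` with their derivations, up to renaming of bound
variables.  The constructors are the five typing rules:
* `bvar x` is the term `x : α` for a variable of base type;
* `nil` is `* : s > s`;
* `run x M` is `x.M : r t > u` for `x : r > s` and `M : s t > u` (the input stacks `r t` and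
  `s t` are given up to a propositional equality);
* `push N M` is `[N].M : s > t` for `N : r` and `M : r s > t`;
* `pop M` is `⟨x⟩.M : r s > t` for `M : s > t` in the context extended by `x : r`. -/
inductive Tm : Ctx S → Ty S → Type u
  | bvar {Γ : Ctx S} {α : S} (x : Var Γ (.base α)) : Tm Γ (.base α)
  | nil {Γ : Ctx S} {s : Stk S} : Tm Γ (.arr s s)
  | run {Γ : Ctx S} {r s t a b v : Stk S} (x : Var Γ (.arr r s))
      (ha : a = r ++ t) (hb : b = s ++ t) (M : Tm Γ (.arr b v)) : Tm Γ (.arr a v)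
  | push {Γ : Ctx S} {r : Ty S} {s t : Stk S} (N : Tm Γ r) (M : Tm Γ (.arr (r :: s) t)) :
      Tm Γ (.arr s t)
  | pop {Γ : Ctx S} {r : Ty S} {s t : Stk S} (M : Tm (r :: Γ) (.arr s t)) :
      Tm Γ (.arr (r :: s) t)

/-- Renamings from `Γ` to `Δ`. -/
def Ren (Γ Δ : Ctx S) : Type u := ∀ ⦃t : Ty S⦄, Var Γ t → Var Δ t

/-- The renaming that weakens by one variable. -/
def Ren.wk {Γ : Ctx S} (r : Ty S) : Ren Γ (r :: Γ)
  | _, x => .succ x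

/-- Composition of renamings. -/
def Ren.trans {Γ Δ Θ : Ctx S} (ρ : Ren Γ Δ) (ρ' : Ren Δ Θ) : Ren Γ Θ
  | _, x => ρ' (ρ x)

/-- Extend a renaming under a binder. -/
def Ren.lift {Γ Δ : Ctx S} (ρ : Ren Γ Δ) (r : Ty S) : Ren (r :: Γ) (r :: Δ)
  | _, .zero => .zero
  | _, .succ x => .succ (ρ x)

namespace Tm

/-- Action of a renaming on terms. -/
def rename : {Γ : Ctx S} → {τ : Ty S} → Tm Γ τ → {Δ : Ctx S} → Ren Γ Δ → Tm Δ τ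
  | _, _, bvar x, _, ρ => bvar (ρ x)
  | _, _, nil, _, _ => nil
  | _, _, run x ha hb M, _, ρ => run (ρ x) ha hb (M.rename ρ)
  | _, _, push N M, _, ρ => push (N.rename ρ) (M.rename ρ)
  | _, _, pop M, _, ρ => pop (M.rename (ρ.lift _))

/-- Weakening by one variable. -/
abbrev wk {Γ : Ctx S} {τ : Ty S} (M : Tm Γ τ) (r : Ty S) : Tm (r :: Γ) τ :=
  M.rename (Ren.wk r)

/-- Change the input stack of a term along an equality. -/
def recast {Γ : Ctx S} {a a' b : Stk S} (h : a = a') (M : Tm Γ (.arr a b)) : Tm Γ (.arr a' b) :=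
  h ▸ M

/-- Auxiliary form of composition `N;M`, recursive in `N`, for `N : a > b` and `M : b t > v`.
The equalities only keep track of the stack types. -/
def compAux : {Γ : Ctx S} → {τ : Ty S} → Tm Γ τ → {a b t c d v : Stk S} → τ = .arr a b →
    c = b ++ t → d = a ++ t → Tm Γ (.arr c v) → Tm Γ (.arr d v)
  | _, _, bvar _, _, _, _, _, _, _, hτ, _, _, _ => nomatch hτ
  | _, _, nil, _, _, _, _, _, _, hτ, hc, hd, K =>
      recast (by injection hτ with h₁ h₂; rw [hc, hd, ← h₁, ← h₂]) K
  | _, _, run (r := r) (t := t₀) x ha hb M, _, _, t, _, _, _, hτ, hc, hd, K =>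
      run (r := r) (t := t₀ ++ t) x
        (by injection hτ with h₁ h₂; rw [hd, ← h₁, ha, List.append_assoc])
        (by rw [hb, List.append_assoc])
        (M.compAux (t := t) rfl (by injection hτ with h₁ h₂; rw [hc, h₂]) rfl K)
  | _, _, push N M, _, _, t, _, _, _, hτ, hc, hd, K =>
      push N (M.compAux (t := t) rfl (by injection hτ with h₁ h₂; rw [hc, h₂])
        (by injection hτ with h₁ h₂; rw [hd, ← h₁]; rfl) K)
  | _, _, pop (r := r) M, _, _, t, _, _, _, hτ, hc, hd, K =>
      recast (by injection hτ with h₁ h₂; rw [hd, ← h₁]; rfl)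
        (pop (M.compAux (t := t) rfl (by injection hτ with h₁ h₂; rw [hc, h₂]) rfl (K.wk r)))

/-- Composition `N;M : a t > v` of `N : a > b` and `M : b t > v`. -/
def comp {Γ : Ctx S} {a b v : Stk S} (t : Stk S) (N : Tm Γ (.arr a b))
    (M : Tm Γ (.arr (b ++ t) v)) : Tm Γ (.arr (a ++ t) v) :=
  N.compAux rfl rfl rfl M

/-- Composition `N;M : a > c` of `N : a > b` and `M : b > c`. -/
def seq {Γ : Ctx S} {a b c : Stk S} (N : Tm Γ (.arr a b)) (M : Tm Γ (.arr b c)) :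
    Tm Γ (.arr a c) :=
  N.compAux (t := []) rfl (List.append_nil b).symm (List.append_nil a).symm M

/-- Expansion: `M : a > b` regarded as a term of type `a t > b t`. -/
def expand {Γ : Ctx S} {a b : Stk S} (M : Tm Γ (.arr a b)) (t : Stk S) :
    Tm Γ (.arr (a ++ t) (b ++ t)) :=
  M.comp t nil

/-- A variable as a term: `x` at base type, `x.*` at arrow type. -/
def var : {Γ : Ctx S} → {t : Ty S} → Var Γ t → Tm Γ t
  | _, .base _, x => bvar x
  | _, .arr r s, x => run (t := []) x (List.append_nil r).symm (List.append_nil s).symm nil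

end Tm

/-- Simultaneous substitutions. -/
def Sub (Γ Δ : Ctx S) : Type u := ∀ ⦃t : Ty S⦄, Var Γ t → Tm Δ t

/-- Extend a substitution under a binder. -/
def Sub.lift {Γ Δ : Ctx S} (σ : Sub Γ Δ) (r : Ty S) : Sub (r :: Γ) (r :: Δ)
  | _, .zero => Tm.var .zero
  | _, .succ x => (σ x).wk r

/-- The substitution `{N/x}` for the most recently bound variable `x`. -/
def Sub.single {Γ : Ctx S} {r : Ty S} (N : Tm Γ r) : Sub (r :: Γ) Γ
  | _, .zero => N
  | _, .succ x => Tm.var x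

namespace Tm

/-- Action of a simultaneous substitution on terms; in particular `{P/x}x.M = P;{P/x}M`. -/
def subst : {Γ : Ctx S} → {τ : Ty S} → Tm Γ τ → {Δ : Ctx S} → Sub Γ Δ → Tm Δ τ
  | _, _, bvar x, _, σ => σ x
  | _, _, nil, _, _ => nil
  | _, _, run x ha hb M, _, σ => (σ x).compAux rfl hb ha (M.subst σ)
  | _, _, push N M, _, σ => push (N.subst σ) (M.subst σ)
  | _, _, pop M, _, σ => pop (M.subst (σ.lift _))

end Tm

/-! Vectors of variables.  Popping a whole stack `s` binds the variables of `s` with the top one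
first, so the body lives in the context `s.reverseAux Γ`, which is `s.reverse ++ Γ`. -/

/-- The context `Γ` extended by a vector of variables of types `s`, popped from the top. -/
abbrev Ctx.ext (Γ : Ctx S) (s : Stk S) : Ctx S := s.reverseAux Γ

/-- Weakening by a vector of variables. -/
def Ren.wkVec : {Γ : Ctx S} → (s : Stk S) → Ren Γ (Ctx.ext Γ s)
  | _, [], _, x => x
  | _, _ :: s, _, x => Ren.wkVec s (Var.succ x)

/-- The variables that are bound when a whole stack `s` is popped. -/
def Ren.bound : {Γ : Ctx S} → (s : Stk S) → Ren s (Ctx.ext Γ s)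
  | _, [], _, x => nomatch x
  | _, _ :: s, _, .zero => Ren.wkVec s Var.zero
  | _, _ :: s, _, .succ x => Ren.bound s x

namespace Tm

/-- Weakening of a term by a vector of variables. -/
abbrev wkVec {Γ : Ctx S} {τ : Ty S} (M : Tm Γ τ) (s : Stk S) : Tm (Ctx.ext Γ s) τ :=
  M.rename (Ren.wkVec s)

/-- Vector abstraction `⟨x⃖⟩.M : s a > b` for `x⃗ : s` and `M : a > b`. -/
def popVec : {Γ : Ctx S} → {a b : Stk S} → (s : Stk S) → Tm (Ctx.ext Γ s) (.arr a b) →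
    Tm Γ (.arr (s ++ a) b)
  | _, _, _, [], M => M
  | _, _, _, _ :: s, M => pop (popVec s M)

/-- Vector abstraction `⟨x⃖⟩.M : s > b` for `x⃗ : s` and `M : ε > b`. -/
def popAll {Γ : Ctx S} {b : Stk S} (s : Stk S) (M : Tm (Ctx.ext Γ s) (.arr [] b)) :
    Tm Γ (.arr s b) :=
  recast (List.append_nil s) (popVec s M)

/-- Vector application `[x⃗].M : a > b` to variables `x⃗ : s`, for `M : s a > b`; the variable
for the top of the stack is pushed last. -/
def pushVec : {Γ : Ctx S} → {a b : Stk S} → (s : Stk S) → Ren s Γ → Tm Γ (.arr (s ++ a) b) →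
    Tm Γ (.arr a b)
  | _, _, _, [], _, M => M
  | _, _, _, _ :: s, xs, M =>
      pushVec s ((Ren.wk _).trans xs) (push (var (xs Var.zero)) M)

/-- Vector application `[x⃗].M : ε > b` to variables `x⃗ : s`, for `M : s > b`. -/
def pushAll {Γ : Ctx S} {b : Stk S} (s : Stk S) (xs : Ren s Γ) (M : Tm Γ (.arr s b)) :
    Tm Γ (.arr [] b) :=
  pushVec s xs (recast (List.append_nil s).symm M)

end Tm

open Tm

/-- The equational theory: the least equivalence that contains the six laws and is closed under
all contexts (under every term constructor, and under composition). -/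
inductive Eqn : {Γ : Ctx S} → {τ : Ty S} → Tm Γ τ → Tm Γ τ → Prop
  | refl {Γ : Ctx S} {τ : Ty S} (M : Tm Γ τ) : Eqn M M
  | symm {Γ : Ctx S} {τ : Ty S} {M N : Tm Γ τ} : Eqn M N → Eqn N M
  | trans {Γ : Ctx S} {τ : Ty S} {M N P : Tm Γ τ} : Eqn M N → Eqn N P → Eqn M P
  | run_congr {Γ : Ctx S} {r s t a b v : Stk S} (x : Var Γ (.arr r s)) (ha : a = r ++ t)
      (hb : b = s ++ t) {M M' : Tm Γ (.arr b v)} :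
      Eqn M M' → Eqn (run x ha hb M) (run x ha hb M')
  | push_congr {Γ : Ctx S} {r : Ty S} {s t : Stk S} {N N' : Tm Γ r}
      {M M' : Tm Γ (.arr (r :: s) t)} : Eqn N N' → Eqn M M' → Eqn (push N M) (push N' M')
  | pop_congr {Γ : Ctx S} {r : Ty S} {s t : Stk S} {M M' : Tm (r :: Γ) (.arr s t)} :
      Eqn M M' → Eqn (pop M) (pop M')
  | comp_congr {Γ : Ctx S} {a b v : Stk S} (t : Stk S) {N N' : Tm Γ (.arr a b)}
      {M M' : Tm Γ (.arr (b ++ t) v)} :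
      Eqn N N' → Eqn M M' → Eqn (comp t N M) (comp t N' M')
  /-- `[N].⟨x⟩.M = {N/x}M : s > t`. -/
  | beta {Γ : Ctx S} {r : Ty S} {s t : Stk S} (N : Tm Γ r) (M : Tm (r :: Γ) (.arr s t)) :
      Eqn (push N (pop M)) (M.subst (Sub.single N))
  /-- `⟨x⃖⟩.N.[x⃗].M = M.⟨y⃖⟩.N.[y⃗] : s r > t u` for `M : s > t` and `N : r > u`. -/
  | interchange {Γ : Ctx S} {s t r v : Stk S} (M : Tm Γ (.arr s t)) (N : Tm Γ (.arr r v)) :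
      Eqn (popVec s (seq (N.wkVec s) (pushVec s (Ren.bound s) (expand (M.wkVec s) v))))
        (comp r M (popVec t (seq (N.wkVec t) (pushVec t (Ren.bound t) nil))))
  /-- `M.⟨y⃖⟩.[y⃗].[y⃗] = ⟨x⃖⟩.[x⃗].M.[x⃗].M : s > t t` for `M : s > t`. -/
  | diagonal {Γ : Ctx S} {s t : Stk S} (M : Tm Γ (.arr s t)) :
      Eqn (seq M (popAll t (pushAll t (Ren.bound t) (pushVec t (Ren.bound t) nil))))
        (popAll s (pushAll s (Ren.bound s)
          (seq (M.wkVec s) (pushVec s (Ren.bound s) (expand (M.wkVec s) t)))))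
  /-- `M.⟨y⃖⟩ = ⟨x⃖⟩ : s > ε` for `M : s > t`. -/
  | terminal {Γ : Ctx S} {s t : Stk S} (M : Tm Γ (.arr s t)) :
      Eqn (seq M (popAll t nil)) (popAll s nil)
  /-- `* = ⟨a⟩.[a] : α > α`. -/
  | eta_base {Γ : Ctx S} (α : S) :
      Eqn (nil : Tm Γ (.arr [.base α] [.base α])) (pop (push (bvar .zero) nil))
  /-- `P = ⟨x⃖⟩.[[x⃗].P.⟨z⟩.z] : r > (s > t)` for `P : r > (s > t)`. -/
  | eta_arr {Γ : Ctx S} {r s t : Stk S} (P : Tm Γ (.arr r [.arr s t])) :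
      Eqn P (popAll r (push (pushVec r (Ren.bound r)
        (comp s (P.wkVec r) (pop (var (Var.zero : Var (Ty.arr s t :: Ctx.ext Γ r) _))))) nil))

/-! Composition is associative with unit `nil`. -/

namespace Tm

theorem rename_recast {Γ Δ : Ctx S} {a a' b : Stk S} (h : a = a') (M : Tm Γ (.arr a b))
    (ρ : Ren Γ Δ) : (recast h M).rename ρ = recast h (M.rename ρ) := by
  subst h; rfl

theorem rename_rename {Γ : Ctx S} {τ : Ty S} (M : Tm Γ τ) : ∀ {Δ Θ : Ctx S} (ρ : Ren Γ Δ)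
    (ρ' : Ren Δ Θ), (M.rename ρ).rename ρ' = M.rename (ρ.trans ρ') := by
  induction M with
  | bvar x => intros; rfl
  | nil => intros; rfl
  | run x ha hb M ih => intro _ _ ρ ρ'; simp only [rename, ih]; rfl
  | push N M ih₁ ih₂ => intro _ _ ρ ρ'; simp only [rename, ih₁, ih₂]
  | pop M ih =>
    intro _ _ ρ ρ'
    simp only [rename, ih]
    congr 2
    funext t x
    cases x <;> rfl

theorem rename_wk {Γ Δ : Ctx S} {τ : Ty S} (M : Tm Γ τ) (r : Ty S) (ρ : Ren Γ Δ) :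
    (M.wk r).rename (ρ.lift r) = (M.rename ρ).wk r := by
  rw [wk, wk, rename_rename, rename_rename]; rfl

theorem rename_compAux {Γ : Ctx S} {τ : Ty S} (N : Tm Γ τ) : ∀ {Δ : Ctx S} {a b t c d v : Stk S}
    (hτ : τ = .arr a b) (hc : c = b ++ t) (hd : d = a ++ t) (M : Tm Γ (.arr c v)) (ρ : Ren Γ Δ),
    (N.compAux hτ hc hd M).rename ρ = (N.rename ρ).compAux hτ hc hd (M.rename ρ) := by
  induction N with
  | bvar x => intro _ _ _ _ _ _ _ hτ; nomatch hτ
  | nil => intros; simp only [compAux, rename, rename_recast]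
  | run x ha hb M ih => intros; simp only [compAux, rename, ih]
  | push N M _ ih => intros; simp only [compAux, rename, ih]
  | pop M ih => intros; simp only [compAux, rename, rename_recast, ih, rename_wk]

theorem compAux_nil {Γ : Ctx S} {τ : Ty S} (N : Tm Γ τ) : ∀ {a b : Stk S} (hτ : τ = .arr a b)
    (hc : b = b ++ []) (hd : a = a ++ []),
    HEq (N.compAux hτ hc hd (nil : Tm Γ (.arr b b))) N := by
  induction N with
  | bvar x => intro _ _ hτ; nomatch hτ
  | nil => intro _ _ hτ _ _; cases hτ; rfl
  | @run Γ r s t a b v x ha hb M ih =>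
    intro _ _ hτ hc hd
    cases hτ
    subst ha hb
    have key : ∀ (t' b' : Stk S) (ht : t' = t) (hb' : b' = s ++ t) (h₁ : r ++ t = r ++ t')
        (h₂ : b' = s ++ t') (M' : Tm Γ (.arr b' v)) (_ : HEq M' M),
        HEq (run x h₁ h₂ M') (run x rfl rfl M) := by
      intro t' b' ht hb' h₁ h₂ M' hM
      subst ht hb'
      cases hM
      rfl
    have key₂ : ∀ (b' : Stk S) (hb' : b' = s ++ t) (h : b' = (s ++ t) ++ []),
        HEq (M.compAux rfl hc h (nil : Tm Γ (.arr v v))) M := by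
      intro b' hb' h
      subst hb'
      exact ih rfl hc h
    exact key _ _ (List.append_nil t) (List.append_nil _) _ _ _ (key₂ _ (List.append_nil _) _)
  | push N M _ ih =>
    intro _ _ hτ hc hd
    cases hτ
    exact heq_of_eq (congrArg (push N) (eq_of_heq (ih rfl hc (List.append_nil _).symm)))
  | @pop Γ r s t M ih =>
    intro _ _ hτ hc hd
    cases hτ
    have key : ∀ (d' : Stk S) (hd' : d' = s) (h : d' = s ++ []) (h' : r :: d' = r :: s),
        recast h' (pop (M.compAux rfl hc h (nil : Tm (r :: Γ) (.arr t t)))) = pop M := by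
      intro d' hd' h h'
      subst hd'
      exact congrArg pop (eq_of_heq (ih rfl hc h))
    exact heq_of_eq (key _ (List.append_nil s) _ _)

theorem recast_compAux {Γ : Ctx S} {a a' b t c d v : Stk S} (h : a = a') (N : Tm Γ (.arr a b))
    (hc : c = b ++ t) (hd : d = a' ++ t) (M : Tm Γ (.arr c v)) :
    (recast h N).compAux rfl hc hd M = N.compAux rfl hc (by rw [hd, h]) M := by
  subst h; rfl

theorem compAux_recast {Γ : Ctx S} {τ : Ty S} {a b t c d d' v : Stk S} (hτ : τ = .arr a b)
    (N : Tm Γ τ) (h : d = d') (hc : c = b ++ t) (hd : d = a ++ t) (M : Tm Γ (.arr c v)) :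
    recast h (N.compAux hτ hc hd M) = N.compAux hτ hc (by rw [← h, hd]) M := by
  subst h; rfl

theorem compAux_assoc {Γ : Ctx S} {τ : Ty S} (N : Tm Γ τ) :
    ∀ {a b t b' c d t' c' d' e v : Stk S}
      (hτ : τ = .arr a b) (hc : c = b ++ t) (hd : d = a ++ t)
      (M : Tm Γ (.arr c b')) (hc' : c' = b' ++ t') (hd' : d' = d ++ t') (he : e = c ++ t')
      (K : Tm Γ (.arr c' v)),
      (N.compAux hτ hc hd M).compAux rfl hc' hd' K =
        N.compAux (t := t ++ t') hτ (by rw [he, hc, List.append_assoc])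
          (by rw [hd', hd, List.append_assoc]) (M.compAux rfl hc' he K) := by
  induction N with
  | bvar x => intro _ _ _ _ _ _ _ _ _ _ _ hτ; nomatch hτ
  | nil =>
    intro _ _ _ _ _ _ _ _ _ _ _ hτ hc hd M hc' hd' he K
    cases hτ
    simp only [compAux]
    rw [recast_compAux, compAux_recast]
  | @run Γ r s t₀ a b v x ha hb M₀ ih =>
    intro _ _ t _ _ _ t' _ _ _ _ hτ hc hd M hc' hd' he K
    cases hτ
    subst ha hb he hc hd hc' hd'
    simp only [compAux, ih]
    have key : ∀ (T T' B B' : Stk S) (hT : T = T') (hB : B = B') (h₁ h₂ h₃ h₄)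
        (w : Stk S) (P : Tm Γ (.arr B w)),
        run (t := T) x h₁ h₂ P = run (t := T') (a := (r ++ t₀ ++ t) ++ t') x h₃ h₄
          (recast hB P) := by
      intro T T' B B' hT hB h₁ h₂ h₃ h₄ w P
      subst hT hB
      rfl
    rw [key _ ((t₀ ++ (t ++ t'))) _ ((s ++ t₀) ++ (t ++ t')) (List.append_assoc _ _ _)
      (List.append_assoc _ _ _) _ _ (by simp) (by simp), compAux_recast]
  | push P M₀ _ ih =>
    intro _ _ _ _ _ _ _ _ _ _ _ hτ hc hd M hc' hd' he K
    cases hτ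
    simp only [compAux]
    exact congrArg (push P) (ih rfl _ _ M hc' _ he K)
  | @pop Γ r s t₀ M₀ ih =>
    intro _ _ t _ _ _ t' _ _ _ _ hτ hc hd M hc' hd' he K
    cases hτ
    subst he hc hd hc' hd'
    have hl : compAux (t := t) (pop M₀) rfl rfl rfl M
        = pop (M₀.compAux (t := t) rfl rfl rfl (M.wk r)) := rfl
    have hw : (M.compAux (t := t') (d := (t₀ ++ t) ++ t') rfl rfl rfl K).wk r
        = (M.wk r).compAux (t := t') rfl rfl rfl (K.wk r) := rename_compAux M _ _ _ K _
    rw [hl]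
    simp only [compAux]
    rw [ih rfl _ _ (M.wk r) rfl _ rfl (K.wk r), hw]
    have key : ∀ (B B' : Stk S) (hB : B = B') (e : r :: B' = (r :: s ++ t) ++ t')
        (e' : r :: B = (r :: s ++ t) ++ t') (w : Stk S) (P : Tm (r :: Γ) (.arr B w)),
        recast e' (pop P) = recast e (pop (recast hB P)) := by
      intro B B' hB e e' w P
      subst hB
      rfl
    rw [key _ (s ++ (t ++ t')) (List.append_assoc _ _ _) (by simp), compAux_recast]

end Tm

theorem Eqn.seq_congr {Γ : Ctx S} {a b c : Stk S} {N N' : Tm Γ (.arr a b)}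
    {M M' : Tm Γ (.arr b c)} (hN : Eqn N N') (hM : Eqn M M') :
    Eqn (seq N M) (seq N' M') := by
  have key : ∀ (c' d' : Stk S) (e : c' = b) (e' : d' = a) (hc : c' = b ++ []) (hd : d' = a ++ [])
      (K K' : Tm Γ (.arr c' c)), Eqn K K' →
      Eqn (N.compAux rfl hc hd K) (N'.compAux rfl hc hd K') := by
    intro c' d' _ _ hc hd K K' hK
    subst hc hd
    exact Eqn.comp_congr [] hN hK
  exact key _ _ rfl rfl _ _ _ _ hM

/-! # The category of terms -/

/-- Objects of the category of terms: stack types. -/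
def TermCat (S : Type u) : Type u := Stk S

/-- The equational theory on closed terms of type `a > b`. -/
def closedSetoid (a b : Stk S) : Setoid (Tm ([] : Ctx S) (.arr a b)) where
  r := Eqn
  iseqv := ⟨Eqn.refl, Eqn.symm, Eqn.trans⟩

/-- Morphisms `a ⟶ b` are closed terms of type `a > b` modulo the equational theory, with
composition `N;M` and identity `*`. -/
instance TermCat.category (S : Type u) : Category.{u} (TermCat S) where
  Hom a b := Quotient (closedSetoid (S := S) a b)
  id a := Quotient.mk (closedSetoid (S := S) a a) nil
  comp {a b c} := Quotient.lift₂
    (fun N M => Quotient.mk (closedSetoid (S := S) a c) (seq N M))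
    (fun _ _ _ _ hN hM => Quotient.sound (Eqn.seq_congr hN hM))
  id_comp f := by
    induction f using Quotient.inductionOn
    rfl
  comp_id {a b} f := by
    induction f using Quotient.inductionOn
    exact congrArg (Quotient.mk (closedSetoid (S := S) a b))
      (eq_of_heq (compAux_nil _ rfl _ _))
  assoc {a b c d} f g h := by
    induction f using Quotient.inductionOn
    induction g using Quotient.inductionOn
    induction h using Quotient.inductionOn
    exact congrArg (Quotient.mk (closedSetoid (S := S) a d)) (compAux_assoc (t := []) (t' := []) _ rfl _ _ _ _ _ (List.append_nil _).symm _)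

/-! # The free Cartesian closed category -/

/-- Objects of the free Cartesian closed category on `S`. -/
inductive FreeCCC (S : Type u) : Type u
  | base : S → FreeCCC S
  | one : FreeCCC S
  | prod : FreeCCC S → FreeCCC S → FreeCCC S
  | exp : FreeCCC S → FreeCCC S → FreeCCC S

namespace FreeCCC

/-- Formal morphisms; `f.comp g` is `f` followed by `g`. -/
inductive Arrow : FreeCCC S → FreeCCC S → Type u
  | id (A : FreeCCC S) : Arrow A A
  | comp {A B C : FreeCCC S} (f : Arrow A B) (g : Arrow B C) : Arrow A C
  | bang (A : FreeCCC S) : Arrow A one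
  | fst (A B : FreeCCC S) : Arrow (prod A B) A
  | snd (A B : FreeCCC S) : Arrow (prod A B) B
  | pair {X A B : FreeCCC S} (f : Arrow X A) (g : Arrow X B) : Arrow X (prod A B)
  | eval (A B : FreeCCC S) : Arrow (prod A (exp A B)) B
  | curry {A X B : FreeCCC S} (f : Arrow (prod A X) B) : Arrow X (exp A B)

/-- The congruence on formal morphisms generated by the equations of Cartesian closed
categories. -/
inductive Rel : {A B : FreeCCC S} → Arrow A B → Arrow A B → Prop
  | refl {A B : FreeCCC S} (f : Arrow A B) : Rel f f
  | symm {A B : FreeCCC S} {f g : Arrow A B} : Rel f g → Rel g f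
  | trans {A B : FreeCCC S} {f g h : Arrow A B} : Rel f g → Rel g h → Rel f h
  | comp_congr {A B C : FreeCCC S} {f f' : Arrow A B} {g g' : Arrow B C} :
      Rel f f' → Rel g g' → Rel (f.comp g) (f'.comp g')
  | pair_congr {X A B : FreeCCC S} {f f' : Arrow X A} {g g' : Arrow X B} :
      Rel f f' → Rel g g' → Rel (f.pair g) (f'.pair g')
  | curry_congr {A X B : FreeCCC S} {f f' : Arrow (prod A X) B} :
      Rel f f' → Rel f.curry f'.curry
  | id_comp {A B : FreeCCC S} (f : Arrow A B) : Rel ((Arrow.id A).comp f) f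
  | comp_id {A B : FreeCCC S} (f : Arrow A B) : Rel (f.comp (Arrow.id B)) f
  | assoc {A B C D : FreeCCC S} (f : Arrow A B) (g : Arrow B C) (h : Arrow C D) :
      Rel ((f.comp g).comp h) (f.comp (g.comp h))
  | bang_uniq {A : FreeCCC S} (f : Arrow A one) : Rel f (Arrow.bang A)
  | pair_fst {X A B : FreeCCC S} (f : Arrow X A) (g : Arrow X B) :
      Rel ((f.pair g).comp (Arrow.fst A B)) f
  | pair_snd {X A B : FreeCCC S} (f : Arrow X A) (g : Arrow X B) :
      Rel ((f.pair g).comp (Arrow.snd A B)) g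
  | pair_eta {X A B : FreeCCC S} (h : Arrow X (prod A B)) :
      Rel ((h.comp (Arrow.fst A B)).pair (h.comp (Arrow.snd A B))) h
  | curry_beta {A X B : FreeCCC S} (f : Arrow (prod A X) B) :
      Rel (((Arrow.fst A X).pair ((Arrow.snd A X).comp f.curry)).comp (Arrow.eval A B)) f
  | curry_eta {A X B : FreeCCC S} (g : Arrow X (exp A B)) :
      Rel (((Arrow.fst A X).pair ((Arrow.snd A X).comp g)).comp (Arrow.eval A B)).curry g

/-- The congruence `Rel` on the formal morphisms from `A` to `B`. -/
def arrowSetoid (A B : FreeCCC S) : Setoid (Arrow A B) where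
  r := Rel
  iseqv := ⟨Rel.refl, Rel.symm, Rel.trans⟩

/-- The free Cartesian closed category on the set `S` of base types. -/
instance category (S : Type u) : Category.{u} (FreeCCC S) where
  Hom A B := Quotient (arrowSetoid A B)
  id A := Quotient.mk (arrowSetoid A A) (Arrow.id A)
  comp {A B C} := Quotient.lift₂ (fun f g => Quotient.mk (arrowSetoid A C) (f.comp g))
    (fun _ _ _ _ hf hg => Quotient.sound (Rel.comp_congr hf hg))
  id_comp f := by
    induction f using Quotient.inductionOn
    exact Quotient.sound (Rel.id_comp _)
  comp_id f := by
    induction f using Quotient.inductionOn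
    exact Quotient.sound (Rel.comp_id _)
  assoc f g h := by
    induction f using Quotient.inductionOn
    induction g using Quotient.inductionOn
    induction h using Quotient.inductionOn
    exact Quotient.sound (Rel.assoc _ _ _)

end FreeCCC

/-! # The canonical functor -/

/-- The interpretation of objects: the terminal object is the empty stack, a product `A × B` is
the stack of `A` with the stack of `B` on top of it, and an exponential is an arrow type. -/
def interpObj : FreeCCC S → Stk S
  | .base α => [.base α]
  | .one => []
  | .prod A B => interpObj B ++ interpObj A
  | .exp A B => [.arr (interpObj A) (interpObj B)]

/-- The interpretation of formal morphisms by the Cartesian closed structure on terms: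
* terminal map `⟨x⃖⟩`;
* projections `⟨x⃖⟩.⟨y⃖⟩.[y⃗]` and `⟨x⃖⟩.⟨y⃖⟩.[x⃗]` (with `x⃗` the upper stack);
* pairing `⟨x⃖⟩.[x⃗].N.[x⃗].M` of `N` and `M`;
* evaluation `⟨z⟩.z`;
* currying `⟨x⃖⟩.[[x⃗].M]` of `M`. -/
def interp : {A B : FreeCCC S} → FreeCCC.Arrow A B →
    Tm ([] : Ctx S) (.arr (interpObj A) (interpObj B))
  | _, _, .id _ => nil
  | _, _, .comp f g => seq (interp f) (interp g)
  | _, _, .bang A => popAll (interpObj A) nil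
  | _, _, .fst A B =>
      popVec (interpObj B) (popAll (interpObj A)
        (pushAll (interpObj A) (Ren.bound (interpObj A)) nil))
  | _, _, .snd A B =>
      popVec (interpObj B) (popAll (interpObj A)
        (pushAll (interpObj B)
          ((Ren.bound (interpObj B)).trans (Ren.wkVec (interpObj A))) nil))
  | X, _, .pair (A := A) f g =>
      popAll (interpObj X) (pushAll (interpObj X) (Ren.bound (interpObj X))
        (seq ((interp f).wkVec (interpObj X))
          (pushVec (interpObj X) (Ren.bound (interpObj X))
            (expand ((interp g).wkVec (interpObj X)) (interpObj A)))))
  | _, _, .eval A B =>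
      pop (var (Var.zero : Var [Ty.arr (interpObj A) (interpObj B)] _))
  | X, _, .curry f =>
      popAll (interpObj X)
        (push (pushVec (interpObj X) (Ren.bound (interpObj X))
          ((interp f).wkVec (interpObj X))) nil)

/-- The interpretation respects the equations of Cartesian closed categories. -/
def InterpSound (S : Type u) : Prop :=
  ∀ ⦃A B : FreeCCC S⦄ (f g : FreeCCC.Arrow A B), FreeCCC.Rel f g → Eqn (interp f) (interp g)

/-- The functor from the free Cartesian closed category to the category of terms that the
interpretation induces. -/
def interpFunctor (S : Type u) (h : InterpSound S) : FreeCCC S ⥤ TermCat S where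
  obj A := interpObj A
  map {A B} := Quotient.lift
    (fun f => Quotient.mk (closedSetoid (interpObj A) (interpObj B)) (interp f))
    (fun f g hfg => Quotient.sound (h f g hfg))
  map_id _ := rfl
  map_comp f g := by
    induction f using Quotient.inductionOn
    induction g using Quotient.inductionOn
    rfl

end FMC

-- Faithfulness is proved by interpreting terms back in the free Cartesian closed category. An arrow
-- type becomes an exponential, a stack type an iterated product, and a term a generalised element
-- over an environment, natural in the stage (`comp_val`). By extensionality of exponentials
-- (`Val.ext`) a term of arrow type is determined by its action on generalised stacks. Composition
-- of terms acts as composition on stacks (`act_compAux`) and substitution as a change of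
-- environment (`val_subst`). The six laws then become identities between computations on stacks, so
-- the value respects the equational theory (`Eqn.val_eq`).
--
-- Passing from an object to its stack type and back returns only an isomorphic object, because
-- concatenation flattens products. The isomorphism is kept in Yoneda form, as the natural bijection
-- `rep`. Along it, the interpretation of a morphism acts by composition with that morphism
-- (`act_interp`). Evaluating at the generic element `𝟙 A` recovers the morphism from the class of
-- its interpretation (`interp_faithful`).
--
-- That the functor exists is a separate, syntactic fact (`interpSound`). The eta laws make terms
-- extensional: it suffices to compare them after feeding them variables (`ext_vec`, `ext_tens`).
-- Only terms without input then matter, and for these the interchange, diagonal and terminal laws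
-- say that outputs can be exchanged, copied and discarded. Hence `tens` behaves as a pair
-- (`tens_fst`, `tens_snd`), and composing with a pairing distributes over its components
-- (`seq_pairTm`). The exponential laws follow from `beta` and `eta_arr`.

namespace FMC

variable {S : Type u}

/-! # Cartesian closed structure of `FreeCCC` -/

namespace FreeCCC

variable {X Y Z A B : FreeCCC S}

/-- The map to the terminal object. -/
def toOne (X : FreeCCC S) : X ⟶ one := Quotient.mk (arrowSetoid X one) (Arrow.bang X)

/-- The first projection. -/
def proj₁ : prod A B ⟶ A := Quotient.mk (arrowSetoid (prod A B) A) (Arrow.fst A B)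

/-- The second projection. -/
def proj₂ : prod A B ⟶ B := Quotient.mk (arrowSetoid (prod A B) B) (Arrow.snd A B)

/-- Pairing. -/
def lift (f : X ⟶ A) (g : X ⟶ B) : X ⟶ prod A B :=
  Quotient.map₂ (sa := arrowSetoid X A) (sb := arrowSetoid X B) (sc := arrowSetoid X (prod A B))
    Arrow.pair (fun _ _ hf _ _ hg => Rel.pair_congr hf hg) f g

/-- Evaluation. -/
def ev (A B : FreeCCC S) : prod A (exp A B) ⟶ B :=
  Quotient.mk (arrowSetoid (prod A (exp A B)) B) (Arrow.eval A B)

/-- Currying. -/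
def lam (f : prod A X ⟶ B) : X ⟶ exp A B :=
  Quotient.map (sa := arrowSetoid (prod A X) B) (sb := arrowSetoid X (exp A B))
    Arrow.curry (fun _ _ hf => Rel.curry_congr hf) f

theorem toOne_uniq (f g : X ⟶ one) : f = g := by
  induction f using Quotient.inductionOn
  induction g using Quotient.inductionOn
  exact Quotient.sound ((Rel.bang_uniq _).trans (Rel.bang_uniq _).symm)

@[simp] theorem lift_proj₁ (f : X ⟶ A) (g : X ⟶ B) : lift f g ≫ proj₁ = f := by
  induction f using Quotient.inductionOn
  induction g using Quotient.inductionOn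
  exact Quotient.sound (Rel.pair_fst _ _)

@[simp] theorem lift_proj₂ (f : X ⟶ A) (g : X ⟶ B) : lift f g ≫ proj₂ = g := by
  induction f using Quotient.inductionOn
  induction g using Quotient.inductionOn
  exact Quotient.sound (Rel.pair_snd _ _)

@[simp] theorem lift_proj₂_assoc (f : X ⟶ A) (g : X ⟶ B) (h : B ⟶ Z) :
    lift f g ≫ proj₂ ≫ h = g ≫ h := by rw [← Category.assoc, lift_proj₂]

theorem lift_eta (h : X ⟶ prod A B) : lift (h ≫ proj₁) (h ≫ proj₂) = h := by
  induction h using Quotient.inductionOn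
  exact Quotient.sound (Rel.pair_eta _)

theorem hom_ext {h k : X ⟶ prod A B} (h₁ : h ≫ proj₁ = k ≫ proj₁) (h₂ : h ≫ proj₂ = k ≫ proj₂) :
    h = k := by
  rw [← lift_eta h, ← lift_eta k, h₁, h₂]

theorem comp_lift (k : Y ⟶ X) (f : X ⟶ A) (g : X ⟶ B) :
    k ≫ lift f g = lift (k ≫ f) (k ≫ g) :=
  hom_ext (by simp) (by simp)

/-- Application of generalised elements. -/
def app (f : X ⟶ exp A B) (a : X ⟶ A) : X ⟶ B := lift a f ≫ ev A B

theorem comp_app (k : Y ⟶ X) (f : X ⟶ exp A B) (a : X ⟶ A) :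
    k ≫ app f a = app (k ≫ f) (k ≫ a) := by
  rw [app, app, ← Category.assoc, comp_lift]

theorem app_proj_lam (f : prod A X ⟶ B) : app (proj₂ ≫ lam f) proj₁ = f := by
  induction f using Quotient.inductionOn
  exact Quotient.sound (Rel.curry_beta _)

theorem lam_app_proj (g : X ⟶ exp A B) : lam (app (proj₂ ≫ g) proj₁) = g := by
  induction g using Quotient.inductionOn
  exact Quotient.sound (Rel.curry_eta _)

/-- The beta law at the generic stage `prod A X`, restricted along the pairing of `a` and `k`. -/
theorem app_comp_lam (k : Y ⟶ X) (f : prod A X ⟶ B) (a : Y ⟶ A) :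
    app (k ≫ lam f) a = lift a k ≫ f := by
  conv_rhs => rw [← app_proj_lam f, comp_app]
  simp

theorem app_lam (f : prod A X ⟶ B) (a : X ⟶ A) : app (lam f) a = lift a (𝟙 X) ≫ f := by
  rw [← app_comp_lam, Category.id_comp]

/-- Only the stage `prod A X` with its two projections is needed: there the hypothesis compares the
uncurried morphisms. -/
theorem exp_ext {f g : X ⟶ exp A B}
    (h : ∀ (Y : FreeCCC S) (k : Y ⟶ X) (a : Y ⟶ A), app (k ≫ f) a = app (k ≫ g) a) : f = g := by
  rw [← lam_app_proj f, ← lam_app_proj g, h]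

end FreeCCC

open FreeCCC

/-! # Interpretation of types, stacks and environments -/

mutual
/-- The object that interprets a type. -/
def tyObj : Ty S → FreeCCC S
  | .base α => .base α
  | .arr s t => .exp (stkObj s) (stkObj t)
/-- The object that interprets a stack type. -/
def stkObj : List (Ty S) → FreeCCC S
  | [] => .one
  | t :: s => .prod (stkObj s) (tyObj t)
end

variable {X Y Z : FreeCCC S}

/-- Generalised elements of a type at stage `X`. -/
abbrev Val (X : FreeCCC S) (t : Ty S) : Type u := X ⟶ tyObj t

/-- Generalised stacks at stage `X`. -/
abbrev Stack (X : FreeCCC S) (s : Stk S) : Type u := X ⟶ stkObj s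

/-- Application of a generalised element of arrow type to a generalised stack. -/
def Val.app {s t : Stk S} (f : Val X (.arr s t)) (x : Stack X s) : Stack X t :=
  FreeCCC.app (A := stkObj s) (B := stkObj t) f x

/-- The element of arrow type that is defined by a family of operations on stacks. -/
def Val.lam {s t : Stk S} (F : ∀ Y : FreeCCC S, (Y ⟶ X) → Stack Y s → Stack Y t) :
    Val X (.arr s t) :=
  FreeCCC.lam (A := stkObj s) (B := stkObj t) (F (.prod (stkObj s) X) proj₂ proj₁)

theorem Val.comp_app {s t : Stk S} (k : Y ⟶ X) (f : Val X (.arr s t)) (x : Stack X s) :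
    k ≫ f.app x = Val.app (k ≫ f) (k ≫ x) :=
  FreeCCC.comp_app k _ _

/-- `Val.lam` records `F` only at the generic stage `prod (stkObj s) X`, on the generic stack
`proj₁`. Naturality recovers `F` everywhere else, by restriction along the pairing of `x` and `k`.
-/
theorem Val.app_comp_lam {s t : Stk S} {F : ∀ Y : FreeCCC S, (Y ⟶ X) → Stack Y s → Stack Y t}
    (hF : ∀ (Y Z : FreeCCC S) (j : Z ⟶ Y) (k : Y ⟶ X) (x : Stack Y s),
      F Z (j ≫ k) (j ≫ x) = j ≫ F Y k x) (k : Y ⟶ X) (x : Stack Y s) :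
    Val.app (k ≫ Val.lam F) x = F Y k x := by
  refine (FreeCCC.app_comp_lam k _ x).trans ?_
  rw [← hF, lift_proj₁, lift_proj₂]

theorem Val.app_lam {s t : Stk S} {F : ∀ Y : FreeCCC S, (Y ⟶ X) → Stack Y s → Stack Y t}
    (hF : ∀ (Y Z : FreeCCC S) (j : Z ⟶ Y) (k : Y ⟶ X) (x : Stack Y s),
      F Z (j ≫ k) (j ≫ x) = j ≫ F Y k x) (x : Stack X s) :
    (Val.lam F).app x = F X (𝟙 X) x := by
  rw [← Val.app_comp_lam hF, Category.id_comp]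

theorem Val.ext {s t : Stk S} {f g : Val X (.arr s t)}
    (h : ∀ (Y : FreeCCC S) (k : Y ⟶ X) (x : Stack Y s), Val.app (k ≫ f) x = Val.app (k ≫ g) x) :
    f = g :=
  FreeCCC.exp_ext h

-- Operations on generalised stacks.

namespace Stack

/-- Put an element on top of a stack. -/
def cons {t : Ty S} {s : Stk S} (v : Val X t) (x : Stack X s) : Stack X (t :: s) :=
  FreeCCC.lift (A := stkObj s) (B := tyObj t) x v

/-- The top element of a stack. -/
def head {t : Ty S} {s : Stk S} (x : Stack X (t :: s)) : Val X t :=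
  x ≫ proj₂ (A := stkObj s) (B := tyObj t)

/-- A stack without its top element. -/
def tail {t : Ty S} {s : Stk S} (x : Stack X (t :: s)) : Stack X s :=
  x ≫ proj₁ (A := stkObj s) (B := tyObj t)

variable {r s t a b c : Stk S} {q : Ty S}

@[simp] theorem head_cons (v : Val X q) (x : Stack X s) : (cons v x).head = v :=
  FreeCCC.lift_proj₂ _ _

@[simp] theorem tail_cons (v : Val X q) (x : Stack X s) : (cons v x).tail = x :=
  FreeCCC.lift_proj₁ _ _

@[simp] theorem cons_head_tail (x : Stack X (q :: s)) : cons x.head x.tail = x :=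
  FreeCCC.lift_eta (A := stkObj s) (B := tyObj q) x

theorem comp_cons (k : Y ⟶ X) (v : Val X q) (x : Stack X s) :
    k ≫ cons v x = cons (k ≫ v) (k ≫ x) :=
  FreeCCC.comp_lift _ _ _

theorem comp_head (k : Y ⟶ X) (x : Stack X (q :: s)) : head (k ≫ x) = k ≫ x.head :=
  Category.assoc _ _ _

theorem comp_tail (k : Y ⟶ X) (x : Stack X (q :: s)) : tail (k ≫ x) = k ≫ x.tail :=
  Category.assoc _ _ _

/-- The empty stack. -/
def nil : Stack X [] := toOne X

theorem eq_nil (x y : Stack X []) : x = y := toOne_uniq (X := X) x y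

/-- Transport of stacks along an equality of stack types. -/
def cast (h : a = b) (x : Stack X a) : Stack X b := h ▸ x

@[simp] theorem cast_rfl (x : Stack X a) : cast rfl x = x := rfl

@[simp] theorem cast_cast (h : a = b) (h' : b = c) (x : Stack X a) :
    cast h' (cast h x) = cast (h.trans h') x := by
  subst h h'; rfl

theorem comp_cast (k : Y ⟶ X) (h : a = b) (x : Stack X a) : k ≫ cast h x = cast h (k ≫ x) := by
  subst h; rfl

theorem cast_cons (h : q :: a = q :: b) (v : Val X q) (x : Stack X a) :
    cast h (cons v x) = cons v (cast (List.cons.inj h).2 x) := by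
  obtain ⟨_, h'⟩ := List.cons.inj h
  subst h'; rfl

/-- Put a stack on top of another. -/
def append : {s : Stk S} → Stack X s → Stack X t → Stack X (s ++ t)
  | [], _, y => y
  | _ :: _, x, y => cons x.head (append x.tail y)

/-- The upper part of a stack. -/
def take : (s : Stk S) → Stack X (s ++ t) → Stack X s
  | [], _ => nil
  | _ :: s, x => cons (head x) (take s (tail x))

/-- The lower part of a stack. -/
def drop : (s : Stk S) → Stack X (s ++ t) → Stack X t
  | [], x => x
  | _ :: s, x => drop s (tail x)

theorem append_cons (x : Stack X (q :: s)) (y : Stack X t) :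
    append x y = cons x.head (append x.tail y) := rfl

@[simp] theorem append_take_drop : (s : Stk S) → (x : Stack X (s ++ t)) →
    append (take s x) (drop s x) = x
  | [], _ => rfl
  | _ :: s, x => by
    simp only [append_cons, take, drop, head_cons, tail_cons]
    rw [append_take_drop s (tail x)]
    exact cons_head_tail (s := s ++ t) x

@[simp] theorem take_append : {s : Stk S} → (x : Stack X s) → (y : Stack X t) →
    take s (append x y) = x
  | [], _, _ => eq_nil _ _
  | _ :: s, x, y => by
    simp only [append_cons, take]
    rw [head_cons, tail_cons, take_append x.tail y, cons_head_tail]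

@[simp] theorem drop_append : {s : Stk S} → (x : Stack X s) → (y : Stack X t) →
    drop s (append x y) = y
  | [], _, _ => rfl
  | _ :: s, x, y => by
    simp only [append_cons, drop]
    rw [tail_cons, drop_append x.tail y]

theorem comp_append (k : Y ⟶ X) : {s : Stk S} → (x : Stack X s) → (y : Stack X t) →
    k ≫ append x y = append (k ≫ x) (k ≫ y)
  | [], _, _ => rfl
  | _ :: s, x, y => by
    simp only [append_cons]
    rw [comp_cons, comp_append k x.tail y, comp_head, comp_tail]

theorem comp_take (k : Y ⟶ X) : (s : Stk S) → (x : Stack X (s ++ t)) →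
    take s (k ≫ x) = k ≫ take s x
  | [], _ => eq_nil _ _
  | _ :: s, x => by
    simp only [take]
    rw [comp_cons, ← comp_take k s, ← comp_head, ← comp_tail]

theorem comp_drop (k : Y ⟶ X) : (s : Stk S) → (x : Stack X (s ++ t)) →
    drop s (k ≫ x) = k ≫ drop s x
  | [], _ => rfl
  | _ :: s, x => by
    simp only [drop]
    rw [← comp_drop k s, ← comp_tail]

/-- Concatenation of lists of types is associative only propositionally, so the law for stacks needs
a transport. It is used to match the equalities stored in `run` with those of a composition. -/
theorem cast_append_assoc : {r : Stk S} → (x : Stack X r) → (y : Stack X s) → (z : Stack X t) →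
    (h : (r ++ s) ++ t = r ++ (s ++ t)) →
    cast h (append (append x y) z) = append x (append y z)
  | [], _, _, _, _ => rfl
  | _ :: r, x, y, z, h => by
    simp only [append_cons]
    rw [head_cons, tail_cons, ← cast_append_assoc x.tail y z (List.append_assoc _ _ _)]
    exact cast_cons _ _ _

theorem cast_append_nil : {r : Stk S} → (x : Stack X r) → (y : Stack X []) → (h : r ++ [] = r) →
    cast h (append x y) = x
  | [], _, _, _ => eq_nil _ _
  | _ :: r, x, y, h => by
    simp only [append_cons]
    conv_rhs => rw [← cons_head_tail x, ← cast_append_nil x.tail y (List.append_nil _)]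
    exact cast_cons _ _ _

end Stack

/-- Generalised environments at stage `X`. -/
def Env (X : FreeCCC S) (Γ : Ctx S) : Type u := ∀ ⦃t : Ty S⦄, Var Γ t → Val X t

namespace Env

variable {Γ Δ : Ctx S} {q : Ty S} {s : Stk S}

/-- Precomposition with a morphism of stages. -/
def comp (k : Y ⟶ X) (γ : Env X Γ) : Env Y Γ := fun _ x => k ≫ γ x

/-- Extension of an environment. -/
def cons (v : Val X q) (γ : Env X Γ) : Env X (q :: Γ)
  | _, .zero => v
  | _, .succ x => γ x

theorem comp_cons (k : Y ⟶ X) (v : Val X q) (γ : Env X Γ) :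
    comp k (cons v γ) = cons (k ≫ v) (comp k γ) := by
  funext t x
  cases x <;> rfl

theorem comp_comp (j : Z ⟶ Y) (k : Y ⟶ X) (γ : Env X Γ) : comp (j ≫ k) γ = comp j (comp k γ) := by
  funext t x
  exact Category.assoc _ _ _

@[simp] theorem comp_id (γ : Env X Γ) : comp (𝟙 X) γ = γ := by
  funext t x
  exact Category.id_comp _

/-- Extension of an environment by a stack of values, the top one first. -/
def ext : {Γ : Ctx S} → (s : Stk S) → Stack X s → Env X Γ → Env X (Ctx.ext Γ s)
  | _, [], _, γ => γ
  | _, _ :: s, x, γ => ext s x.tail (cons x.head γ)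

/-- The stack of the values of an environment. -/
def toStack : (s : Stk S) → Env X s → Stack X s
  | [], _ => Stack.nil
  | _ :: s, γ => Stack.cons (γ .zero) (toStack s (fun _ x => γ (.succ x)))

/-- The environment of the values of a stack. -/
def ofStack : (s : Stk S) → Stack X s → Env X s
  | [], _ => fun _ x => nomatch x
  | _ :: s, x => cons x.head (ofStack s x.tail)

theorem toStack_ofStack : (s : Stk S) → (x : Stack X s) → toStack s (ofStack s x) = x
  | [], _ => Stack.eq_nil _ _
  | _ :: s, x => by
    have := toStack_ofStack s x.tail
    simp only [toStack, ofStack, cons]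
    exact (congrArg _ this).trans (Stack.cons_head_tail x)

theorem ext_wkVec : {Γ : Ctx S} → (s : Stk S) → (x : Stack X s) → (γ : Env X Γ) → {t : Ty S} →
    (y : Var Γ t) → ext s x γ (Ren.wkVec s y) = γ y
  | _, [], _, _, _, _ => rfl
  | _, _ :: s, x, γ, _, y => ext_wkVec s x.tail (cons x.head γ) (.succ y)

theorem ext_bound : {Γ : Ctx S} → (s : Stk S) → (x : Stack X s) → (γ : Env X Γ) → {t : Ty S} →
    (y : Var s t) → ext s x γ (Ren.bound s y) = ofStack s x y
  | _, _ :: s, x, γ, _, .zero => ext_wkVec s x.tail (cons x.head γ) .zero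
  | _, _ :: s, x, γ, _, .succ y => ext_bound s x.tail (cons x.head γ) y

end Env

/-! # Interpretation of terms -/

namespace Env

variable {Γ Δ : Ctx S}

/-- Precomposition with a renaming. -/
def ren (ρ : Ren Γ Δ) (γ : Env X Δ) : Env X Γ := fun _ x => γ (ρ x)

theorem comp_ren (k : Y ⟶ X) (ρ : Ren Γ Δ) (γ : Env X Δ) :
    comp k (ren ρ γ) = ren ρ (comp k γ) := rfl

theorem ren_trans {Θ : Ctx S} (ρ : Ren Γ Δ) (ρ' : Ren Δ Θ) (γ : Env X Θ) :
    ren (ρ.trans ρ') γ = ren ρ (ren ρ' γ) := rfl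

theorem ren_lift (ρ : Ren Γ Δ) {q : Ty S} (v : Val X q) (γ : Env X Δ) :
    ren (ρ.lift q) (cons v γ) = cons v (ren ρ γ) := by
  funext t y
  cases y <;> rfl

@[simp] theorem ren_wkVec_ext (s : Stk S) (x : Stack X s) (γ : Env X Γ) :
    ren (Ren.wkVec s) (ext s x γ) = γ := by
  funext t y
  exact ext_wkVec s x γ y

@[simp] theorem ren_bound_ext (s : Stk S) (x : Stack X s) (γ : Env X Γ) :
    ren (Ren.bound s) (ext s x γ) = ofStack s x := by
  funext t y
  exact ext_bound s x γ y

theorem comp_ofStack (k : Y ⟶ X) : (s : Stk S) → (x : Stack X s) →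
    comp k (ofStack s x) = ofStack s (k ≫ x)
  | [], _ => by funext t y; nomatch y
  | _ :: s, x => by
    simp only [ofStack]
    rw [comp_cons, comp_ofStack k s x.tail, ← Stack.comp_head, ← Stack.comp_tail]

end Env

namespace Tm

/-- The value of a term in an environment. -/
def val : {Γ : Ctx S} → {τ : Ty S} → Tm Γ τ → {X : FreeCCC S} → Env X Γ → Val X τ
  | _, _, bvar x, _, γ => γ x
  | _, _, nil, _, _ => Val.lam fun _ _ x => x
  | _, _, run (r := r) x ha hb M, _, γ => Val.lam fun _ k st =>
      (M.val (γ.comp k)).app (((Val.app (k ≫ γ x) ((st.cast ha).take r)).append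
        ((st.cast ha).drop r)).cast hb.symm)
  | _, _, push N M, _, γ => Val.lam fun _ k st =>
      (M.val (γ.comp k)).app (Stack.cons (N.val (γ.comp k)) st)
  | _, _, pop M, _, γ => Val.lam fun _ k st =>
      (M.val (Env.cons st.head (γ.comp k))).app st.tail

/-- Apart from a base variable, every clause of `val` is a `Val.lam`, which computes as expected
only for natural families. Naturality of the family comes from that of the subterms, so the
induction proves both together. -/
theorem comp_val {Γ : Ctx S} {τ : Ty S} (M : Tm Γ τ) : ∀ {X Y : FreeCCC S} (j : Y ⟶ X)
    (γ : Env X Γ), M.val (γ.comp j) = j ≫ M.val γ := by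
  induction M with
  | bvar x => intros; rfl
  | nil =>
    intro X Y j γ
    refine Val.ext fun Z k x => ?_
    simp only [val]
    rw [Val.app_comp_lam (fun _ _ _ _ _ => rfl), ← Category.assoc,
      Val.app_comp_lam (fun _ _ _ _ _ => rfl)]
  | run y ha hb M ih =>
    intro X Y j γ
    refine Val.ext fun Z k x => ?_
    simp only [val]
    -- The stage is arbitrary because the fact is used twice: for the restricted environment at `Y`
    -- and for the original one at `X`.
    have h : ∀ {X : FreeCCC S} (γ : Env X _), ∀ (Y Z : FreeCCC S) (j : Z ⟶ Y) (k : Y ⟶ X)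
      (st : Stack Y _), (M.val (γ.comp (j ≫ k))).app (((Val.app ((j ≫ k) ≫ γ y)
        ((Stack.cast ha (j ≫ st)).take _)).append ((Stack.cast ha (j ≫ st)).drop _)).cast hb.symm) =
        j ≫ (M.val (γ.comp k)).app (((Val.app (k ≫ γ y)
        ((st.cast ha).take _)).append ((st.cast ha).drop _)).cast hb.symm) := by
      intro X γ Y Z j k st
      rw [Val.comp_app, Env.comp_comp, ih j, Stack.comp_cast, Stack.comp_append, Val.comp_app,
        ← Stack.comp_take, ← Stack.comp_drop, Stack.comp_cast, Category.assoc]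
    rw [Val.app_comp_lam (h _), ← Category.assoc, Val.app_comp_lam (h _), Env.comp_comp]
    simp only [Env.comp, Category.assoc]
  | push N M ih₁ ih₂ =>
    intro X Y j γ
    refine Val.ext fun Z k x => ?_
    simp only [val]
    have h : ∀ {X : FreeCCC S} (γ : Env X _), ∀ (Y Z : FreeCCC S) (j : Z ⟶ Y) (k : Y ⟶ X)
      (st : Stack Y _), (M.val (γ.comp (j ≫ k))).app (Stack.cons (N.val (γ.comp (j ≫ k))) (j ≫ st))
        = j ≫ (M.val (γ.comp k)).app (Stack.cons (N.val (γ.comp k)) st) := by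
      intro X γ Y Z j k st
      rw [Val.comp_app, Env.comp_comp, ih₂ j, ih₁ j, Stack.comp_cons]
    rw [Val.app_comp_lam (h _), ← Category.assoc, Val.app_comp_lam (h _), Env.comp_comp]
  | pop M ih =>
    intro X Y j γ
    refine Val.ext fun Z k x => ?_
    simp only [val]
    have h : ∀ {X : FreeCCC S} (γ : Env X _), ∀ (Y Z : FreeCCC S) (j : Z ⟶ Y) (k : Y ⟶ X)
      (st : Stack Y _), (M.val (Env.cons (Stack.head (j ≫ st)) (γ.comp (j ≫ k)))).app
          (Stack.tail (j ≫ st))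
        = j ≫ (M.val (Env.cons st.head (γ.comp k))).app st.tail := by
      intro X γ Y Z j k st
      rw [Val.comp_app, Env.comp_comp, Stack.comp_head, ← Env.comp_cons, ih j, Stack.comp_tail]
    rw [Val.app_comp_lam (h _), ← Category.assoc, Val.app_comp_lam (h _), Env.comp_comp]

/-- The operation on stacks that a term of arrow type performs in an environment. -/
def act {Γ : Ctx S} {a b : Stk S} (M : Tm Γ (.arr a b)) {X : FreeCCC S} (γ : Env X Γ)
    (x : Stack X a) : Stack X b :=
  (M.val γ).app x

variable {Γ Δ : Ctx S} {a b c d r s t v : Stk S} {q : Ty S}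

theorem comp_act (M : Tm Γ (.arr a b)) (k : Y ⟶ X) (γ : Env X Γ) (x : Stack X a) :
    k ≫ M.act γ x = M.act (γ.comp k) (k ≫ x) := by
  rw [act, act, Val.comp_app, comp_val]

/-- The stacks have to range over all later stages, as there may be none at `X` itself. By
`comp_val`, restricting the value amounts to restricting the environment. -/
theorem val_ext {M N : Tm Γ (.arr a b)} {γ : Env X Γ}
    (h : ∀ (Y : FreeCCC S) (k : Y ⟶ X) (x : Stack Y a), M.act (γ.comp k) x = N.act (γ.comp k) x) :
    M.val γ = N.val γ := by
  refine Val.ext fun Y k x => ?_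
  rw [← comp_val, ← comp_val]
  exact h Y k x

@[simp] theorem act_nil (γ : Env X Γ) (x : Stack X a) : (nil : Tm Γ (.arr a a)).act γ x = x :=
  Val.app_lam (fun _ _ _ _ _ => rfl) x

theorem act_run (y : Var Γ (.arr r s)) (ha : a = r ++ t) (hb : b = s ++ t) (M : Tm Γ (.arr b v))
    (γ : Env X Γ) (x : Stack X a) :
    (run y ha hb M).act γ x = M.act γ (((Val.app (γ y) ((x.cast ha).take r)).append
        ((x.cast ha).drop r)).cast hb.symm) := by
  refine (Val.app_lam ?_ x).trans ?_
  · intro Y Z j k st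
    rw [Val.comp_app, Env.comp_comp, comp_val, Stack.comp_cast, Stack.comp_append, Val.comp_app,
        ← Stack.comp_take, ← Stack.comp_drop, Stack.comp_cast, Category.assoc]
  · simp only [Env.comp_id, Category.id_comp]
    rfl

@[simp] theorem act_push (N : Tm Γ q) (M : Tm Γ (.arr (q :: s) t)) (γ : Env X Γ) (x : Stack X s) :
    (push N M).act γ x = M.act γ (Stack.cons (N.val γ) x) := by
  refine (Val.app_lam ?_ x).trans ?_
  · intro Y Z j k st
    rw [Val.comp_app, Env.comp_comp, comp_val M j, comp_val N j, Stack.comp_cons]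
  · simp only [Env.comp_id]
    rfl

@[simp] theorem act_pop (M : Tm (q :: Γ) (.arr s t)) (γ : Env X Γ) (x : Stack X (q :: s)) :
    (pop M).act γ x = M.act (Env.cons x.head γ) x.tail := by
  refine (Val.app_lam ?_ x).trans ?_
  · intro Y Z j k st
    rw [Val.comp_app, Env.comp_comp, Stack.comp_head, ← Env.comp_cons, comp_val, Stack.comp_tail]
  · simp only [Env.comp_id]
    rfl

theorem act_recast (h : a = b) (M : Tm Γ (.arr a c)) (γ : Env X Γ) (x : Stack X b) :
    (recast h M).act γ x = M.act γ (x.cast h.symm) := by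
  subst h; rfl

@[simp] theorem val_var : {t : Ty S} → (y : Var Γ t) → (γ : Env X Γ) → (var y).val γ = γ y
  | .base _, _, _ => rfl
  | .arr r s, y, γ => by
    refine Val.ext fun Y k x => ?_
    rw [← comp_val]
    refine (act_run (t := []) y _ _ nil _ x).trans ?_
    rw [act_nil]
    -- The lower part has the empty stack type, so reassembling the two parts shows that the upper
    -- part is already all of `x`.
    have h : (Stack.append ((x.cast (List.append_nil r).symm).take r)
        ((x.cast (List.append_nil r).symm).drop r)).cast (List.append_nil r) = x := by
      simp
    rw [Stack.cast_append_nil] at h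
    rw [h, Stack.cast_append_nil]
    rfl

theorem act_var (y : Var Γ (.arr a b)) (γ : Env X Γ) (x : Stack X a) :
    (var y).act γ x = Val.app (γ y) x := by
  rw [act, val_var]

theorem val_rename (M : Tm Γ q) : ∀ {Δ : Ctx S} (ρ : Ren Γ Δ) {X : FreeCCC S} (γ : Env X Δ),
    (M.rename ρ).val γ = M.val (γ.ren ρ) := by
  induction M with
  | bvar x => intros; rfl
  | nil => intros; rfl
  | run x ha hb M ih =>
    intro Δ ρ X γ
    refine Val.ext fun Y k x => ?_
    rw [← comp_val, ← comp_val, Env.comp_ren]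
    refine (act_run _ _ _ _ _ _).trans (Eq.trans ?_ (act_run _ _ _ _ _ _).symm)
    rw [act, act, ih]
    rfl
  | push N M ih₁ ih₂ =>
    intro Δ ρ X γ
    refine Val.ext fun Y k x => ?_
    rw [← comp_val, ← comp_val, Env.comp_ren]
    refine (act_push _ _ _ _).trans (Eq.trans ?_ (act_push _ _ _ _).symm)
    rw [act, act, ih₁, ih₂]
  | pop M ih =>
    intro Δ ρ X γ
    refine Val.ext fun Y k x => ?_
    rw [← comp_val, ← comp_val, Env.comp_ren]
    refine (act_pop _ _ _).trans (Eq.trans ?_ (act_pop _ _ _).symm)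
    rw [act, act, ih, Env.ren_lift]

theorem act_rename (M : Tm Γ (.arr a b)) (ρ : Ren Γ Δ) (γ : Env X Δ) (x : Stack X a) :
    (M.rename ρ).act γ x = M.act (γ.ren ρ) x := by
  rw [act, act, val_rename]

theorem val_wk (M : Tm Γ q) (r : Ty S) (v : Val X r) (γ : Env X Γ) :
    (M.wk r).val (Env.cons v γ) = M.val γ :=
  val_rename _ _ _

theorem act_wk (M : Tm Γ (.arr a b)) (r : Ty S) (v : Val X r) (γ : Env X Γ) (x : Stack X a) :
    (M.wk r).act (Env.cons v γ) x = M.act γ x :=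
  act_rename _ _ _ _

theorem act_wkVec (M : Tm Γ (.arr a b)) (s : Stk S) (y : Stack X s) (γ : Env X Γ) (x : Stack X a) :
    (M.wkVec s).act (γ.ext s y) x = M.act γ x := by
  rw [wkVec, act_rename, Env.ren_wkVec_ext]

/-- `N` touches only the upper part `x`, and `y` is carried along unchanged to `K`. Variables popped
by `N` do not occur in `K`, which is what `act_wk` contributes. -/
theorem act_compAux {τ : Ty S} (N : Tm Γ τ) : ∀ {a b t c d v : Stk S} (hτ : τ = .arr a b)
    (hc : c = b ++ t) (hd : d = a ++ t) (K : Tm Γ (.arr c v)) {X : FreeCCC S} (γ : Env X Γ)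
    (x : Stack X a) (y : Stack X t), (N.compAux hτ hc hd K).act γ ((x.append y).cast hd.symm) =
      K.act γ ((Stack.append ((hτ ▸ N : Tm Γ (.arr a b)).act γ x) y).cast hc.symm) := by
  induction N with
  | bvar x => intro _ _ _ _ _ _ hτ; nomatch hτ
  | nil =>
    intro _ _ _ _ _ _ hτ hc hd K X γ x y
    cases hτ
    subst hc
    simp only [compAux, act_recast, act_nil, Stack.cast_cast]
  | @run Γ r s t₀ a b v z ha hb M ih =>
    intro _ _ t _ _ _ hτ hc hd K X γ x y
    cases hτ
    subst ha hb hc hd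
    simp only [compAux, act_run, Stack.cast_rfl]
    -- Once `x` is written as an `append`, its parts can be computed, and the remaining transports
    -- are reassociations.
    have e := Stack.append_take_drop r x
    generalize x.take r = x₁ at *
    generalize x.drop r = x₂ at *
    subst e
    rw [Stack.cast_append_assoc, Stack.take_append, Stack.drop_append]
    rw [← Stack.cast_append_assoc _ _ _ (List.append_assoc _ _ _), Stack.cast_cast]
    exact ih rfl rfl rfl K γ _ y
  | push N M _ ih =>
    intro _ _ _ _ _ _ hτ hc hd K X γ x y
    cases hτ
    subst hc hd
    simp only [compAux, act_push, Stack.cast_rfl]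
    refine Eq.trans ?_ (ih rfl rfl rfl K γ (Stack.cons (N.val γ) x) y)
    simp only [Stack.append_cons, Stack.head_cons, Stack.tail_cons, Stack.cast_rfl]
  | pop M ih =>
    intro _ _ _ _ _ _ hτ hc hd K X γ x y
    cases hτ
    subst hc hd
    simp only [compAux, act_pop, act_recast, Stack.cast_rfl, Stack.append_cons]
    rw [Stack.head_cons, Stack.tail_cons]
    refine (ih rfl rfl rfl (K.wk _) _ x.tail y).trans ?_
    rw [act_wk]
    rfl

theorem act_comp (N : Tm Γ (.arr a b)) (M : Tm Γ (.arr (b ++ t) v)) (γ : Env X Γ) (x : Stack X a)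
    (y : Stack X t) : (comp t N M).act γ (x.append y) = M.act γ ((N.act γ x).append y) :=
  act_compAux N rfl rfl rfl M γ x y

@[simp] theorem act_expand (N : Tm Γ (.arr a b)) (γ : Env X Γ) (x : Stack X a)
    (y : Stack X t) : (expand N t).act γ (x.append y) = (N.act γ x).append y :=
  (act_comp N nil γ x y).trans (act_nil _ _)

@[simp] theorem act_seq (N : Tm Γ (.arr a b)) (M : Tm Γ (.arr b v)) (γ : Env X Γ)
    (x : Stack X a) : (seq N M).act γ x = M.act γ (N.act γ x) := by
  have h := act_compAux N (t := []) rfl (List.append_nil b).symm (List.append_nil a).symm M γ x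
    Stack.nil
  rwa [Stack.cast_append_nil, Stack.cast_append_nil] at h

/-- The environment of the values of a substitution. -/
def _root_.FMC.Env.sub (σ : Sub Γ Δ) (γ : Env X Δ) : Env X Γ := fun _ x => (σ x).val γ

theorem _root_.FMC.Env.comp_sub (k : Y ⟶ X) (σ : Sub Γ Δ) (γ : Env X Δ) :
    Env.comp k (γ.sub σ) = (γ.comp k).sub σ := by
  funext t x
  exact (comp_val _ _ _).symm

/-- In the case `run`, substitution turns the head variable into a composition, whose action is
known from `act_compAux`. Under a binder the lifted substitution gives the extended environment. -/
theorem val_subst {τ : Ty S} (M : Tm Γ τ) : ∀ {Δ : Ctx S} (σ : Sub Γ Δ) {X : FreeCCC S}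
    (γ : Env X Δ), (M.subst σ).val γ = M.val (γ.sub σ) := by
  induction M with
  | bvar x => intros; rfl
  | nil => intros; rfl
  | run y ha hb M ih =>
    intro Δ σ X γ
    refine Val.ext fun Y k x => ?_
    rw [← comp_val, ← comp_val, Env.comp_sub]
    refine Eq.trans ?_ (act_run _ _ _ _ _ _).symm
    subst ha hb
    have e := Stack.append_take_drop _ x
    refine Eq.trans (congrArg _ e.symm) ?_
    refine (act_compAux (σ y) rfl rfl rfl (M.subst σ) (γ.comp k) _ _).trans ?_
    rw [act, act, ih]
    rfl
  | push N M ih₁ ih₂ =>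
    intro Δ σ X γ
    refine Val.ext fun Y k x => ?_
    rw [← comp_val, ← comp_val, Env.comp_sub]
    refine (act_push _ _ _ _).trans (Eq.trans ?_ (act_push _ _ _ _).symm)
    rw [act, act, ih₁, ih₂]
  | pop M ih =>
    intro Δ σ X γ
    refine Val.ext fun Y k x => ?_
    rw [← comp_val, ← comp_val, Env.comp_sub]
    refine (act_pop _ _ _).trans (Eq.trans ?_ (act_pop _ _ _).symm)
    rw [act, act, ih]
    congr 2
    funext t y
    cases y with
    | zero => exact val_var _ _
    | succ y => exact val_wk (σ y) _ _ _

theorem act_popVec : {Γ : Ctx S} → {a b : Stk S} → (s : Stk S) →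
    (M : Tm (Ctx.ext Γ s) (.arr a b)) → (γ : Env X Γ) → (x : Stack X s) → (y : Stack X a) →
    (popVec s M).act γ (x.append y) = M.act (γ.ext s x) y
  | _, _, _, [], _, _, _, _ => rfl
  | _, _, _, q :: s, M, γ, x, y => by
    refine (act_pop (popVec s M) γ _).trans ?_
    simp only [Stack.append_cons]
    rw [Stack.head_cons, Stack.tail_cons, act_popVec s M _ x.tail y]
    rfl

theorem act_popAll (s : Stk S) (M : Tm (Ctx.ext Γ s) (.arr [] b)) (γ : Env X Γ)
    (x : Stack X s) : (popAll s M).act γ x = M.act (γ.ext s x) Stack.nil := by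
  rw [popAll, act_recast, ← act_popVec]
  conv_lhs => rw [← Stack.cast_append_nil x Stack.nil (List.append_nil s), Stack.cast_cast]
  rfl

theorem act_pushVec : {Γ : Ctx S} → {a b : Stk S} → (s : Stk S) → (xs : Ren s Γ) →
    (M : Tm Γ (.arr (s ++ a) b)) → (γ : Env X Γ) → (y : Stack X a) →
    (pushVec s xs M).act γ y =
      M.act γ ((Env.toStack s (γ.ren xs)).append y)
  | _, _, _, [], _, _, _, _ => rfl
  | _, _, _, q :: s, xs, M, γ, y => by
    simp only [pushVec]
    have h : Env.toStack (q :: s) (γ.ren xs) =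
      Stack.cons (γ (xs .zero)) (Env.toStack s (γ.ren ((Ren.wk q).trans xs))) := rfl
    rw [act_pushVec s, act_push, val_var, Stack.append_cons, h, Stack.head_cons, Stack.tail_cons]

theorem act_pushAll (s : Stk S) (xs : Ren s Γ) (M : Tm Γ (.arr s b)) (γ : Env X Γ)
    (y : Stack X []) : (pushAll s xs M).act γ y = M.act γ (Env.toStack s (γ.ren xs)) := by
  rw [pushAll, act_pushVec, act_recast, Stack.cast_append_nil]

theorem toStack_ext_bound (s : Stk S) (x : Stack X s) (γ : Env X Γ) :
    Env.toStack s ((γ.ext s x).ren (Ren.bound s)) = x := by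
  rw [Env.ren_bound_ext, Env.toStack_ofStack]

theorem act_pushVec_bound (s : Stk S) (M : Tm (Ctx.ext Γ s) (.arr (s ++ a) b)) (γ : Env X Γ)
    (x : Stack X s) (y : Stack X a) :
    (pushVec s (Ren.bound s) M).act (γ.ext s x) y = M.act (γ.ext s x) (x.append y) := by
  rw [act_pushVec, toStack_ext_bound]

theorem act_pushAll_bound (s : Stk S) (M : Tm (Ctx.ext Γ s) (.arr s b)) (γ : Env X Γ)
    (x : Stack X s) (y : Stack X []) :
    (pushAll s (Ren.bound s) M).act (γ.ext s x) y = M.act (γ.ext s x) x := by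
  rw [act_pushAll, toStack_ext_bound]

end Tm

-- Soundness of the equational theory in the free Cartesian closed category.

open Tm

theorem act_ext_append {Γ : Ctx S} {a b s : Stk S} {M N : Tm Γ (.arr (s ++ a) b)} {γ : Env X Γ}
    (h : ∀ (Y : FreeCCC S) (k : Y ⟶ X) (x : Stack Y s) (y : Stack Y a),
      M.act (γ.comp k) (x.append y) = N.act (γ.comp k) (x.append y)) :
    M.val γ = N.val γ :=
  val_ext fun Y k x => by
    rw [← Stack.append_take_drop s x]
    exact h _ _ _ _

/-- Equal terms have equal values. -/
theorem Eqn.val_eq {Γ : Ctx S} {τ : Ty S} {M N : Tm Γ τ} (h : Eqn M N) :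
    ∀ {X : FreeCCC S} (γ : Env X Γ), M.val γ = N.val γ := by
  induction h with
  | refl => intros; rfl
  | symm _ ih => intro X γ; exact (ih γ).symm
  | trans _ _ ih₁ ih₂ => intro X γ; exact (ih₁ γ).trans (ih₂ γ)
  | run_congr x ha hb _ ih =>
    intro X γ
    refine val_ext fun Y k x => ?_
    rw [act_run, act_run, act, act, ih]
  | push_congr _ _ ih₁ ih₂ =>
    intro X γ
    refine val_ext fun Y k x => ?_
    rw [act_push, act_push, act, act, ih₁, ih₂]
  | pop_congr _ ih =>
    intro X γ
    refine val_ext fun Y k x => ?_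
    rw [act_pop, act_pop, act, act, ih]
  | comp_congr t _ _ ih₁ ih₂ =>
    intro X γ
    refine act_ext_append fun Y k x y => ?_
    rw [act_comp, act_comp]
    simp only [act, ih₁, ih₂]
  | beta N M =>
    intro X γ
    refine val_ext fun Y k x => ?_
    rw [act_push, act_pop, Stack.head_cons, Stack.tail_cons]
    rw [act, act, val_subst]
    congr 2
    funext t y
    cases y with
    | zero => rfl
    | succ y => exact (val_var y (γ.comp k)).symm
  | interchange M N =>
    intro X γ
    refine act_ext_append fun Y k x y => ?_
    -- Both sides compute the output of `M` on `x`, on top of the output of `N` on `y`.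
    rw [act_popVec, act_seq, act_pushVec_bound, act_wkVec, act_expand, act_wkVec, act_comp,
      act_popVec, act_seq, act_pushVec_bound, act_wkVec, act_nil]
  | diagonal M =>
    intro X γ
    refine val_ext fun Y k x => ?_
    rw [act_seq, act_popAll, act_pushAll_bound, act_pushVec_bound, act_nil, act_popAll,
      act_pushAll_bound, act_seq, act_pushVec_bound, act_wkVec, act_expand, act_wkVec]
  | terminal M =>
    intro X γ
    exact val_ext fun Y k x => Stack.eq_nil _ _
  | eta_base α =>
    intro X γ
    refine val_ext fun Y k x => ?_
    rw [act_pop, act_push, act_nil, act_nil]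
    exact (Stack.cons_head_tail x).symm
  | @eta_arr _ r s t P =>
    intro X γ
    refine val_ext fun Y k x => ?_
    rw [act_popAll, act_push, act_nil]
    -- The output of `P` is a stack with a single element, so only the top is compared, by applying
    -- it to a stack at a later stage.
    have hx := Stack.cons_head_tail (P.act (γ.comp k) x)
    rw [← hx, Stack.eq_nil (Stack.tail _) Stack.nil]
    congr 1
    refine Val.ext fun Z j y => ?_
    rw [← comp_val]
    refine Eq.trans ?_ (act_pushVec _ _ _ _ _).symm
    have e : Env.toStack r ((((γ.comp k).ext r x).comp j).ren (Ren.bound r)) = j ≫ x := by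
      rw [← Env.comp_ren, Env.ren_bound_ext, Env.comp_ofStack, Env.toStack_ofStack]
    rw [e, act_comp, act_pop]
    rw [← comp_act, act_wkVec, Stack.append_cons, Stack.head_cons, Stack.tail_cons,
      Stack.comp_head, act_var]
    rfl

/-! # Elements of objects of `FreeCCC` as stacks -/

/-- A natural bijection between generalised elements of `A` and stacks of type `s`. -/
structure StackRep (A : FreeCCC S) (s : Stk S) where
  /-- The stack that represents a generalised element. -/
  up : ∀ {X : FreeCCC S}, (X ⟶ A) → Stack X s
  /-- The generalised element that a stack represents. -/
  dn : ∀ {X : FreeCCC S}, Stack X s → (X ⟶ A)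
  comp_up : ∀ {X Y : FreeCCC S} (k : Y ⟶ X) (f : X ⟶ A), k ≫ up f = up (k ≫ f)
  dn_up : ∀ {X : FreeCCC S} (f : X ⟶ A), dn (up f) = f
  up_dn : ∀ {X : FreeCCC S} (x : Stack X s), up (dn x) = x

namespace StackRep

variable {A B : FreeCCC S} {s t : Stk S}

/-- The inverse of a natural bijection is natural. -/
theorem comp_dn (R : StackRep A s) (k : Y ⟶ X) (x : Stack X s) : k ≫ R.dn x = R.dn (k ≫ x) := by
  rw [← R.dn_up (k ≫ R.dn x), ← R.comp_up, R.up_dn]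

/-- The representation of a base type. -/
def base (α : S) : StackRep (.base α) [.base α] where
  up f := Stack.cons (t := .base α) f Stack.nil
  dn x := Stack.head (t := .base α) x
  comp_up k f := by
    refine (Stack.comp_cons (q := .base α) k f Stack.nil).trans ?_
    rw [Stack.eq_nil (k ≫ Stack.nil) Stack.nil]
    rfl
  dn_up f := Stack.head_cons (q := .base α) f _
  up_dn x := by
    rw [Stack.eq_nil Stack.nil (Stack.tail x)]
    exact Stack.cons_head_tail _

/-- The representation of the terminal object. -/
def one : StackRep (S := S) .one [] where
  up _ := Stack.nil
  dn _ := toOne _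
  comp_up _ _ := Stack.eq_nil _ _
  dn_up _ := toOne_uniq _ _
  up_dn _ := Stack.eq_nil _ _

/-- The representation of a product. -/
def prod (R : StackRep A s) (T : StackRep B t) : StackRep (.prod A B) (t ++ s) where
  up f := Stack.append (T.up (f ≫ proj₂)) (R.up (f ≫ proj₁))
  dn x := lift (R.dn (x.drop t)) (T.dn (x.take t))
  comp_up k f := by
    rw [Stack.comp_append, R.comp_up, T.comp_up, Category.assoc, Category.assoc]
  dn_up f := by
    rw [Stack.take_append, Stack.drop_append, R.dn_up, T.dn_up, lift_eta]
  up_dn x := by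
    rw [lift_proj₁, lift_proj₂, R.up_dn, T.up_dn, Stack.append_take_drop]

/-- The element of arrow type that represents an element of an exponential. -/
def expVal (R : StackRep A s) (T : StackRep B t) (f : X ⟶ .exp A B) : Val X (.arr s t) :=
  Val.lam fun _ k x => T.up (app (k ≫ f) (R.dn x))

theorem app_comp_expVal (R : StackRep A s) (T : StackRep B t) (f : X ⟶ .exp A B) (k : Y ⟶ X)
    (x : Stack Y s) : Val.app (k ≫ expVal R T f) x = T.up (app (k ≫ f) (R.dn x)) := by
  refine Val.app_comp_lam ?_ k x
  intro Y Z j k x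
  rw [T.comp_up, FreeCCC.comp_app, R.comp_dn, Category.assoc]

theorem app_expVal (R : StackRep A s) (T : StackRep B t) (f : X ⟶ .exp A B) (x : Stack X s) :
    Val.app (expVal R T f) x = T.up (app f (R.dn x)) := by
  rw [← Category.id_comp (expVal R T f), app_comp_expVal, Category.id_comp]

/-- The representation of an exponential. -/
def exp (R : StackRep A s) (T : StackRep B t) : StackRep (.exp A B) [.arr s t] where
  up f := Stack.cons (expVal R T f) Stack.nil
  dn x := FreeCCC.lam (T.dn (Val.app (proj₂ ≫ Stack.head x) (R.up proj₁)))
  comp_up k f := by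
    rw [Stack.comp_cons, Stack.eq_nil (k ≫ Stack.nil) Stack.nil]
    congr 1
    refine Val.ext fun Z j x => ?_
    rw [← Category.assoc, app_comp_expVal, app_comp_expVal, Category.assoc]
  dn_up f := by
    refine exp_ext fun Y k a => ?_
    rw [app_comp_lam, Stack.head_cons, T.comp_dn, Val.comp_app, ← Category.assoc, lift_proj₂,
      R.comp_up, lift_proj₁, app_comp_expVal, T.dn_up, R.dn_up]
  up_dn x := by
    refine Eq.trans ?_ (Stack.cons_head_tail _)
    rw [Stack.eq_nil Stack.nil (Stack.tail x)]
    congr 1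
    refine Val.ext fun Y k y => ?_
    rw [app_comp_expVal, app_comp_lam, T.comp_dn, T.up_dn, Val.comp_app, R.comp_up, lift_proj₁, R.up_dn,
      lift_proj₂_assoc]

theorem up_prod_lift (R : StackRep A s) (T : StackRep B t) (f : X ⟶ A) (g : X ⟶ B) :
    (R.prod T).up (lift f g) = Stack.append (T.up g) (R.up f) := by
  simp [prod]

theorem up_prod_exp (R : StackRep A s) (T : StackRep B t) (f : X ⟶ .prod A (.exp A B)) :
    (R.prod (R.exp T)).up f = Stack.cons (expVal R T (f ≫ proj₂)) (R.up (f ≫ proj₁)) := by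
  simp only [prod, exp]
  rw [Stack.append_cons, Stack.head_cons, Stack.tail_cons]
  rfl

end StackRep

/-- Elements of `A` are represented by stacks of type `interpObj A`. -/
def rep : (A : FreeCCC S) → StackRep A (interpObj A)
  | .base α => .base α
  | .one => .one
  | .prod A B => .prod (rep A) (rep B)
  | .exp A B => .exp (rep A) (rep B)

/-- The empty environment. -/
def Env.nil : Env X [] := fun _ y => nomatch y

/-- The class of a formal morphism. -/
def FreeCCC.Arrow.hom {A B : FreeCCC S} (f : Arrow A B) : A ⟶ B := Quotient.mk (arrowSetoid A B) f

/-- The interpretation acts on stacks as the given morphism acts on elements. -/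
theorem act_interp {A B : FreeCCC S} (f : Arrow A B) : ∀ {X : FreeCCC S} (γ : Env X [])
    (a : X ⟶ A), (interp f).act γ ((rep A).up a) = (rep B).up (a ≫ f.hom) := by
  induction f with
  | id A =>
    intro X γ a
    exact (act_nil _ _).trans (congrArg _ (Category.comp_id a).symm)
  | comp f g ihf ihg =>
    intro X γ a
    rw [interp, act_seq, ihf, ihg, Category.assoc]
    rfl
  | bang A =>
    intro X γ a
    exact Stack.eq_nil _ _
  | fst A B =>
    intro X γ a
    refine (act_popVec _ _ _ ((rep B).up (a ≫ proj₂)) ((rep A).up (a ≫ proj₁))).trans ?_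
    rw [act_popAll, act_pushAll_bound, act_nil]
    rfl
  | snd A B =>
    intro X γ a
    refine (act_popVec _ _ _ ((rep B).up (a ≫ proj₂)) ((rep A).up (a ≫ proj₁))).trans ?_
    rw [act_popAll, act_pushAll, act_nil]
    rw [Env.ren_trans, Env.ren_wkVec_ext, toStack_ext_bound]
    rfl
  | @pair X' A B f g ihf ihg =>
    intro X γ a
    refine (act_popAll _ _ _ _).trans ((act_pushAll_bound _ _ _ _ _).trans ((act_seq _ _ _ _).trans
      ((act_pushVec_bound _ _ _ _ _).trans ((act_expand _ _ _ _).trans ?_))))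
    rw [act_wkVec]
    rw [act_wkVec, ihf, ihg]
    have h : a ≫ (f.pair g).hom = lift (a ≫ f.hom) (a ≫ g.hom) := comp_lift a f.hom g.hom
    refine Eq.trans ?_ (congrArg _ h.symm)
    refine Eq.trans ?_ (StackRep.up_prod_lift (rep A) (rep B) (a ≫ f.hom) (a ≫ g.hom)).symm
    rfl
  | eval A B =>
    intro X γ a
    refine (congrArg _ (StackRep.up_prod_exp (rep A) (rep B) a)).trans ((act_pop _ _ _).trans ?_)
    rw [act_var, Env.cons, Stack.head_cons, Stack.tail_cons, StackRep.app_expVal, StackRep.dn_up,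
      app, lift_eta]
    rfl
  | @curry A X' B f ih =>
    intro X γ a
    refine (act_popAll _ _ _ _).trans ((act_push _ _ _ _).trans ((act_nil _ _).trans ?_))
    refine congrArg (fun v => Stack.cons v Stack.nil) (Val.ext fun Y k x => ?_)
    refine Eq.trans ?_ (StackRep.app_comp_expVal (rep A) (rep B) _ k x).symm
    rw [← comp_val]
    refine (act_pushVec _ _ _ _ _).trans ?_
    rw [← Env.comp_ren, Env.ren_bound_ext, Env.comp_ofStack, Env.toStack_ofStack]
    refine (act_rename _ _ _ _).trans ?_
    rw [← Env.comp_ren, Env.ren_wkVec_ext, StackRep.comp_up]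
    -- The body of the closure runs at the later stage `Y`, on the argument `x` with the captured
    -- stack, restricted along `k`, on top of it. This is why the induction ranges over all stages.
    have h := ih (γ.comp k) (lift ((rep A).dn x) (k ≫ a))
    rw [← Category.assoc]
    refine Eq.trans ?_ (congrArg _ (app_comp_lam (k ≫ a) f.hom ((rep A).dn x)).symm)
    refine Eq.trans ?_ h
    refine congrArg _ (Eq.trans ?_ (StackRep.up_prod_lift (rep A) (rep X') _ _).symm)
    rw [StackRep.up_dn]

/-- By `act_interp` at the generic element `𝟙 A`, the term determines the represented morphism, and
`up` is injective since `dn` inverts it. -/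
theorem interp_faithful {A B : FreeCCC S} (f g : Arrow A B) (h : Eqn (interp f) (interp g)) :
    f.hom = g.hom := by
  have e : (rep B).up (𝟙 A ≫ f.hom) = (rep B).up (𝟙 A ≫ g.hom) := by
    rw [← act_interp f Env.nil, ← act_interp g Env.nil, act, act, h.val_eq]
  rw [Category.id_comp, Category.id_comp] at e
  rw [← (rep B).dn_up f.hom, e, (rep B).dn_up]

/-! # Renaming and composition of terms -/

namespace Ren

variable {Γ Δ Θ : Ctx S}

/-- Extend a renaming under a vector of binders. -/
def liftVec : {Γ Δ : Ctx S} → (s : Stk S) → Ren Γ Δ → Ren (Ctx.ext Γ s) (Ctx.ext Δ s)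
  | _, _, [], ρ => ρ
  | _, _, q :: s, ρ => liftVec s (ρ.lift q)

/-- Extend a renaming by a variable. -/
def cons {q : Ty S} (x : Var Δ q) (ρ : Ren Γ Δ) : Ren (q :: Γ) Δ
  | _, .zero => x
  | _, .succ y => ρ y

/-- Instantiation of the last vector of variables. -/
def inst : {Γ Δ : Ctx S} → (s : Stk S) → Ren s Δ → Ren Γ Δ → Ren (Ctx.ext Γ s) Δ
  | _, _, [], _, ρ => ρ
  | _, _, _ :: s, xs, ρ => inst s ((Ren.wk _).trans xs) (cons (xs .zero) ρ)

theorem wkVec_liftVec : {Γ Δ : Ctx S} → (s : Stk S) → (ρ : Ren Γ Δ) → {t : Ty S} → (x : Var Γ t) →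
    liftVec s ρ (wkVec s x) = wkVec s (ρ x)
  | _, _, [], _, _, _ => rfl
  | _, _, _ :: s, ρ, _, x => wkVec_liftVec s (ρ.lift _) x.succ

theorem bound_liftVec : {Γ Δ : Ctx S} → (s : Stk S) → (ρ : Ren Γ Δ) → {t : Ty S} → (x : Var s t) →
    liftVec s ρ (bound s x) = bound s x
  | _, _, q :: s, ρ, _, .zero => wkVec_liftVec s (ρ.lift q) .zero
  | _, _, q :: s, ρ, _, .succ x => bound_liftVec s (ρ.lift q) x

theorem wkVec_inst : {Γ Δ : Ctx S} → (s : Stk S) → (xs : Ren s Δ) → (ρ : Ren Γ Δ) → {t : Ty S} →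
    (x : Var Γ t) → inst s xs ρ (wkVec s x) = ρ x
  | _, _, [], _, _, _, _ => rfl
  | _, _, _ :: s, xs, _, _, x => wkVec_inst s ((Ren.wk _).trans xs) _ x.succ

theorem bound_inst : {Γ Δ : Ctx S} → (s : Stk S) → (xs : Ren s Δ) → (ρ : Ren Γ Δ) → {t : Ty S} →
    (x : Var s t) → inst s xs ρ (bound s x) = xs x
  | _, _, _ :: s, xs, _, _, .zero => wkVec_inst s ((Ren.wk _).trans xs) _ .zero
  | _, _, _ :: s, xs, _, _, .succ x => bound_inst s ((Ren.wk _).trans xs) _ x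

@[simp] theorem wkVec_trans_liftVec (s : Stk S) (ρ : Ren Γ Δ) :
    (wkVec s).trans (liftVec s ρ) = ρ.trans (wkVec s) := by
  funext t x
  exact wkVec_liftVec s ρ x

@[simp] theorem bound_trans_liftVec (s : Stk S) (ρ : Ren Γ Δ) :
    (bound s).trans (liftVec s ρ) = bound s := by
  funext t x
  exact bound_liftVec s ρ x

@[simp] theorem wkVec_trans_inst (s : Stk S) (xs : Ren s Δ) (ρ : Ren Γ Δ) :
    (wkVec s).trans (inst s xs ρ) = ρ := by
  funext t x
  exact wkVec_inst s xs ρ x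

@[simp] theorem bound_trans_inst (s : Stk S) (xs : Ren s Δ) (ρ : Ren Γ Δ) :
    (bound s).trans (inst s xs ρ) = xs := by
  funext t x
  exact bound_inst s xs ρ x

/-- Lets `beta_vec` contract one variable at a time and collect the results into a single
instantiation. -/
theorem liftVec_trans_inst : {Γ Δ Θ : Ctx S} → (s : Stk S) → (σ : Ren Γ Δ) → (xs : Ren s Θ) →
    (ρ : Ren Δ Θ) → (liftVec s σ).trans (inst s xs ρ) = inst s xs (σ.trans ρ)
  | _, _, _, [], _, _, _ => rfl
  | _, _, _, q :: s, σ, xs, ρ => by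
    refine (liftVec_trans_inst s (σ.lift q) _ _).trans ?_
    simp only [inst]
    congr 1
    funext t y
    cases y <;> rfl

/-- The identity renaming. -/
def id (Γ : Ctx S) : Ren Γ Γ := fun _ x => x

@[simp] theorem lift_zero (ρ : Ren Γ Δ) (r : Ty S) : ρ.lift r (Var.zero) = Var.zero := rfl

theorem lift_id (r : Ty S) : (id Γ).lift r = id (r :: Γ) := by
  funext t y
  cases y <;> rfl

@[simp] theorem trans_id (ρ : Ren Γ Δ) : ρ.trans (id Δ) = ρ := rfl

theorem trans_assoc {Λ : Ctx S} (ρ : Ren Γ Δ) (σ : Ren Δ Θ) (τ : Ren Θ Λ) :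
    (ρ.trans σ).trans τ = ρ.trans (σ.trans τ) := rfl

end Ren

namespace Tm

variable {Γ Δ : Ctx S} {a b c d r s t v : Stk S} {q τ : Ty S}

@[simp] theorem rename_id (M : Tm Γ τ) : M.rename (Ren.id Γ) = M := by
  induction M with
  | bvar => rfl
  | nil => rfl
  | run x ha hb M ih => simp only [rename, ih]; rfl
  | push N M ih₁ ih₂ => simp only [rename, ih₁, ih₂]
  | pop M ih => simp only [rename, Ren.lift_id, ih]

@[simp] theorem rename_nil (ρ : Ren Γ Δ) : (nil : Tm Γ (.arr a a)).rename ρ = nil := rfl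

@[simp] theorem rename_push (N : Tm Γ q) (M : Tm Γ (.arr (q :: s) t)) (ρ : Ren Γ Δ) :
    (push N M).rename ρ = push (N.rename ρ) (M.rename ρ) := rfl

@[simp] theorem rename_pop (M : Tm (q :: Γ) (.arr s t)) (ρ : Ren Γ Δ) :
    (pop M).rename ρ = pop (M.rename (ρ.lift q)) := rfl

@[simp] theorem rename_var : {t : Ty S} → (x : Var Γ t) → (ρ : Ren Γ Δ) →
    (var x).rename ρ = var (ρ x)
  | .base _, _, _ => rfl
  | .arr _ _, _, _ => rfl

theorem compAux_var (y : Var Γ (.arr r s)) (hb : b = s ++ t) (ha : a = r ++ t)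
    (K : Tm Γ (.arr b v)) : (var y).compAux rfl hb ha K = run y ha hb K := by
  subst ha hb; rfl

/-- Makes the contraction of a redex with a variable as argument a mere renaming, so the vector laws
need no calculus of substitutions. -/
theorem subst_var (M : Tm Γ τ) : ∀ {Δ : Ctx S} (ρ : Ren Γ Δ),
    M.subst (fun _ x => var (ρ x)) = M.rename ρ := by
  induction M with
  | bvar => intros; rfl
  | nil => intros; rfl
  | run x ha hb M ih => intro Δ ρ; simp only [subst, rename, ih, compAux_var]
  | push N M ih₁ ih₂ => intro Δ ρ; simp only [subst, rename, ih₁, ih₂]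
  | pop M ih =>
    intro Δ ρ
    simp only [subst, rename, ← ih]
    congr 2
    funext t y
    cases y with
    | zero => rfl
    | succ y => exact rename_var _ _

theorem rename_subst (M : Tm Γ τ) : ∀ {Δ Θ : Ctx S} (σ : Sub Γ Δ) (ρ : Ren Δ Θ),
    (M.subst σ).rename ρ = M.subst (fun _ x => (σ x).rename ρ) := by
  induction M with
  | bvar => intros; rfl
  | nil => intros; rfl
  | run x ha hb M ih => intro Δ Θ σ ρ; simp only [subst, rename_compAux, ih]
  | push N M ih₁ ih₂ => intro Δ Θ σ ρ; simp only [subst, rename, ih₁, ih₂]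
  | pop M ih =>
    intro Δ Θ σ ρ
    simp only [subst, rename, ih]
    congr 2
    funext t y
    cases y with
    | zero => exact rename_var _ _
    | succ y => exact rename_wk _ _ _

theorem subst_rename (M : Tm Γ τ) : ∀ {Δ Θ : Ctx S} (ρ : Ren Γ Δ) (σ : Sub Δ Θ),
    (M.rename ρ).subst σ = M.subst (fun _ x => σ (ρ x)) := by
  induction M with
  | bvar => intros; rfl
  | nil => intros; rfl
  | run x ha hb M ih => intro Δ Θ σ ρ; simp only [subst, rename, ih]
  | push N M ih₁ ih₂ => intro Δ Θ σ ρ; simp only [subst, rename, ih₁, ih₂]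
  | pop M ih =>
    intro Δ Θ σ ρ
    simp only [subst, rename, ih]
    congr 2
    funext t y
    cases y <;> rfl

theorem rename_subst_single (N : Tm Γ q) (M : Tm (q :: Γ) τ) (ρ : Ren Γ Δ) :
    (M.subst (Sub.single N)).rename ρ = (M.rename (ρ.lift q)).subst (Sub.single (N.rename ρ)) := by
  rw [rename_subst, subst_rename]
  congr 1
  funext t y
  cases y with
  | zero => rfl
  | succ y => exact rename_var _ _

@[simp] theorem rename_comp (N : Tm Γ (.arr a b)) (M : Tm Γ (.arr (b ++ t) v)) (ρ : Ren Γ Δ) :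
    (comp t N M).rename ρ = comp t (N.rename ρ) (M.rename ρ) :=
  rename_compAux _ _ _ _ _ _

@[simp] theorem rename_seq (N : Tm Γ (.arr a b)) (M : Tm Γ (.arr b v)) (ρ : Ren Γ Δ) :
    (seq N M).rename ρ = seq (N.rename ρ) (M.rename ρ) :=
  rename_compAux _ _ _ _ _ _

@[simp] theorem rename_expand (N : Tm Γ (.arr a b)) (ρ : Ren Γ Δ) :
    (expand N t).rename ρ = expand (N.rename ρ) t :=
  rename_comp _ _ _

@[simp] theorem rename_popVec : {Γ Δ : Ctx S} → (s : Stk S) → (M : Tm (Ctx.ext Γ s) (.arr a b)) →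
    (ρ : Ren Γ Δ) → (popVec s M).rename ρ = popVec s (M.rename (ρ.liftVec s))
  | _, _, [], _, _ => rfl
  | _, _, q :: s, M, ρ => congrArg pop (rename_popVec s M (ρ.lift q))

@[simp] theorem rename_popAll (s : Stk S) (M : Tm (Ctx.ext Γ s) (.arr [] b)) (ρ : Ren Γ Δ) :
    (popAll s M).rename ρ = popAll s (M.rename (ρ.liftVec s)) := by
  rw [popAll, rename_recast, rename_popVec, popAll]

@[simp] theorem rename_pushVec : (s : Stk S) → (xs : Ren s Γ) → {a b : Stk S} →
    (M : Tm Γ (.arr (s ++ a) b)) →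
    (ρ : Ren Γ Δ) → (pushVec s xs M).rename ρ = pushVec s (xs.trans ρ) (M.rename ρ)
  | [], _, _, _, _, _ => rfl
  | q :: s, xs, _, _, M, ρ => by
    refine (rename_pushVec s ((Ren.wk _).trans xs) _ ρ).trans ?_
    simp only [rename, rename_var]
    rfl

@[simp] theorem rename_pushAll (s : Stk S) (xs : Ren s Γ) (M : Tm Γ (.arr s b)) (ρ : Ren Γ Δ) :
    (pushAll s xs M).rename ρ = pushAll s (xs.trans ρ) (M.rename ρ) := by
  rw [pushAll, rename_pushVec, rename_recast, pushAll]

/-! ### Associativity -/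

theorem compAux_tail {a b t t' c d v : Stk S} (h : t = t') (N : Tm Γ (.arr a b)) (hc : c = b ++ t)
    (hd : d = a ++ t) (K : Tm Γ (.arr c v)) :
    N.compAux rfl hc hd K = N.compAux (t := t') rfl (h ▸ hc) (h ▸ hd) K := by
  subst h; rfl

theorem seq_assoc (N : Tm Γ (.arr a b)) (M : Tm Γ (.arr b c)) (K : Tm Γ (.arr c d)) :
    seq (seq N M) K = seq N (seq M K) :=
  compAux_assoc (t := []) (t' := []) N rfl _ _ M _ _ (List.append_nil _).symm K

theorem comp_seq (N : Tm Γ (.arr a b)) (M : Tm Γ (.arr b c)) (K : Tm Γ (.arr (c ++ t) d)) :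
    comp t (seq N M) K = comp t N (comp t M K) :=
  compAux_assoc (t := []) (t' := t) N rfl _ _ M _ _ rfl K

theorem seq_comp (N : Tm Γ (.arr a b)) (M : Tm Γ (.arr (b ++ t) c)) (K : Tm Γ (.arr c d)) :
    seq (comp t N M) K = comp t N (seq M K) :=
  (compAux_assoc (t := t) (t' := []) N rfl _ _ M _ _ (List.append_nil _).symm K).trans
    (compAux_tail (List.append_nil t) _ _ _ _)

@[simp] theorem seq_nil (N : Tm Γ (.arr a b)) : seq N nil = N := eq_of_heq (compAux_nil N rfl _ _)

@[simp] theorem nil_seq (N : Tm Γ (.arr a b)) : seq nil N = N := rfl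

theorem compAux_popVec : {Γ : Ctx S} → {a b t c d v : Stk S} → (s : Stk S) →
    (M : Tm (Ctx.ext Γ s) (.arr a b)) →
    (hc : c = b ++ t) → (hd : d = (s ++ a) ++ t) → (K : Tm Γ (.arr c v)) →
    (popVec s M).compAux rfl hc hd K =
      recast (by rw [hd, List.append_assoc]) (popVec s (M.compAux rfl hc rfl (K.wkVec s)))
  | _, _, _, _, _, _, _, [], M, hc, hd, K => by
    subst hd
    exact congrArg _ (rename_id K).symm
  | Γ, a, b, t, c, d, v, q :: s, M, hc, hd, K => by
    subst hd
    have h := compAux_popVec s M hc rfl (K.wk q)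
    have e : (K.wk q).wkVec s = K.wkVec (Γ := Γ) (q :: s) := rename_rename _ _ _
    rw [e] at h
    have h' : (popVec (q :: s) M).compAux rfl hc rfl K =
      pop ((popVec s M).compAux rfl hc rfl (K.wk q)) := rfl
    rw [h', h]
    have key : ∀ (x y : Stk S) (h : x = y) (h' : q :: x = q :: y) (L : Tm (q :: Γ) (.arr x v)),
        pop (recast h L) = recast h' (pop L) := by
      intro x y h h' L
      subst h; rfl
    exact key _ _ _ _ _

theorem seq_popVec (s : Stk S) (M : Tm (Ctx.ext Γ s) (.arr a b)) (K : Tm Γ (.arr b c)) :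
    seq (popVec s M) K = popVec s (seq M (K.wkVec s)) := by
  refine (compAux_popVec s M _ _ K).trans ?_
  -- `a ++ []` equals `a` only propositionally; replacing it by a free `x` lets the equation be
  -- eliminated.
  have key : ∀ (x : Stk S) (h : x = a ++ []) (h₁ : x = a) (h₂ : s ++ x = s ++ a),
      recast h₂ (popVec s (M.compAux rfl (List.append_nil b).symm h (K.wkVec s))) =
        popVec s (M.compAux rfl (List.append_nil b).symm (h₁ ▸ h) (K.wkVec s)) := by
    intro x h h₁ h₂
    subst h₁; rfl
  exact key _ _ (List.append_nil a) _

theorem comp_popAll (s : Stk S) (M : Tm (Ctx.ext Γ s) (.arr [] b)) (K : Tm Γ (.arr (b ++ t) c)) :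
    comp t (popAll s M) K = popVec s (comp t M (K.wkVec s)) := by
  refine (recast_compAux _ _ _ _ _).trans ((compAux_popVec s M _ _ K).trans ?_)
  rfl

theorem seq_popAll (s : Stk S) (M : Tm (Ctx.ext Γ s) (.arr [] b)) (K : Tm Γ (.arr b c)) :
    seq (popAll s M) K = popAll s (seq M (K.wkVec s)) := by
  refine (recast_compAux _ _ _ _ _).trans ((compAux_popVec s M _ _ K).trans ?_)
  rfl

theorem compAux_pushVec : (s : Stk S) → {a b t c d v : Stk S} → (xs : Ren s Γ) →
    (M : Tm Γ (.arr (s ++ a) b)) →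
    (hc : c = b ++ t) → (hd : d = a ++ t) → (K : Tm Γ (.arr c v)) →
    (pushVec s xs M).compAux rfl hc hd K =
      pushVec s xs (M.compAux rfl hc (by rw [hd, List.append_assoc]) K)
  | [], _, _, _, _, _, _, _, _, _, _, _ => rfl
  | q :: s, a, b, t, c, d, v, xs, M, hc, hd, K => by
    subst hd
    refine (compAux_pushVec s ((Ren.wk _).trans xs) (push (var (xs .zero)) M) hc rfl K).trans ?_
    simp only [compAux, pushVec]

/-- The term `[x⃗].*`. -/
abbrev vec (s : Stk S) (xs : Ren s Γ) : Tm Γ (.arr [] s) := pushAll s xs nil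

theorem comp_vec (s : Stk S) (xs : Ren s Γ) (M : Tm Γ (.arr (s ++ a) b)) :
    comp a (vec s xs) M = pushVec s xs M := by
  refine (compAux_pushVec s xs _ _ _ _).trans ?_
  rw [recast_compAux]
  rfl

theorem seq_vec (s : Stk S) (xs : Ren s Γ) (M : Tm Γ (.arr s b)) :
    seq (vec s xs) M = pushAll s xs M := by
  refine (compAux_pushVec s xs _ _ _ _).trans ?_
  rw [recast_compAux, pushAll]
  congr 1

end Tm

/-! # Closure properties of the equational theory -/

/-- The equational theory is closed under renaming. -/
theorem Eqn.rename {Γ : Ctx S} {τ : Ty S} {M N : Tm Γ τ} (h : Eqn M N) :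
    ∀ {Δ : Ctx S} (ρ : Ren Γ Δ), Eqn (M.rename ρ) (N.rename ρ) := by
  induction h with
  | refl => intros; exact .refl _
  | symm _ ih => intro Δ ρ; exact (ih ρ).symm
  | trans _ _ ih₁ ih₂ => intro Δ ρ; exact (ih₁ ρ).trans (ih₂ ρ)
  | run_congr x ha hb _ ih => intro Δ ρ; exact .run_congr _ ha hb (ih ρ)
  | push_congr _ _ ih₁ ih₂ => intro Δ ρ; exact .push_congr (ih₁ ρ) (ih₂ ρ)
  | pop_congr _ ih => intro Δ ρ; exact .pop_congr (ih _)
  | comp_congr t _ _ ih₁ ih₂ =>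
    intro Δ ρ
    rw [rename_comp, rename_comp]
    exact .comp_congr t (ih₁ ρ) (ih₂ ρ)
  | beta N M =>
    intro Δ ρ
    rw [rename_subst_single]
    exact .beta _ _
  | @interchange _ s t r v M N =>
    intro Δ ρ
    have h := Eqn.interchange (M.rename ρ) (N.rename ρ)
    simpa only [rename_popVec, rename_seq, rename_pushVec, rename_expand, rename_comp, wkVec,
      rename_rename, Ren.wkVec_trans_liftVec, Ren.bound_trans_liftVec, rename_nil] using h
  | @diagonal _ s t M =>
    intro Δ ρ
    have h := Eqn.diagonal (M.rename ρ)
    simpa only [rename_popAll, rename_pushAll, rename_seq, rename_pushVec, rename_expand, wkVec,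
      rename_rename, Ren.wkVec_trans_liftVec, Ren.bound_trans_liftVec, rename_nil, rename_pop, rename_push, Ren.lift_zero] using h
  | @terminal _ s t M =>
    intro Δ ρ
    have h := Eqn.terminal (M.rename ρ)
    simpa only [rename_popAll, rename_seq, Tm.rename] using h
  | eta_base α => intro Δ ρ; exact .eta_base α
  | @eta_arr _ r s t P =>
    intro Δ ρ
    have h := Eqn.eta_arr (P.rename ρ)
    simpa only [rename_popAll, rename_seq, rename_pushVec, rename_comp, wkVec, rename_var,
      rename_rename, Ren.wkVec_trans_liftVec, Ren.bound_trans_liftVec, rename_nil, rename_pop, rename_push, Ren.lift_zero] using h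

variable {Γ Δ : Ctx S} {a b c d r s t v : Stk S} {q τ : Ty S}

instance : Trans (Eqn (Γ := Γ) (τ := τ)) (Eqn (Γ := Γ) (τ := τ)) (Eqn (Γ := Γ) (τ := τ)) :=
  ⟨Eqn.trans⟩

-- Beta, eta and extensionality for vectors of variables.

namespace Eqn

theorem of_eq {M N : Tm Γ τ} (h : M = N) : Eqn M N := h ▸ refl M

theorem recast_congr (h : a = b) {M N : Tm Γ (.arr a c)} (e : Eqn M N) :
    Eqn (recast h M) (recast h N) := by
  subst h; exact e

theorem popVec_congr : {Γ : Ctx S} → (s : Stk S) → {M N : Tm (Ctx.ext Γ s) (.arr a b)} →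
    Eqn M N → Eqn (popVec s M) (popVec s N)
  | _, [], _, _, e => e
  | _, _ :: s, _, _, e => pop_congr (popVec_congr s e)

theorem popAll_congr (s : Stk S) {M N : Tm (Ctx.ext Γ s) (.arr [] b)} (e : Eqn M N) :
    Eqn (popAll s M) (popAll s N) :=
  recast_congr _ (popVec_congr s e)

theorem pushVec_congr : (s : Stk S) → (xs : Ren s Γ) → {a b : Stk S} →
    {M N : Tm Γ (.arr (s ++ a) b)} → Eqn M N → Eqn (pushVec s xs M) (pushVec s xs N)
  | [], _, _, _, _, _, e => e
  | _ :: s, xs, _, _, _, _, e => pushVec_congr s ((Ren.wk _).trans xs) (push_congr (refl _) e)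

theorem pushAll_congr (s : Stk S) (xs : Ren s Γ) {M N : Tm Γ (.arr s b)} (e : Eqn M N) :
    Eqn (pushAll s xs M) (pushAll s xs N) :=
  pushVec_congr s xs (recast_congr _ e)

theorem seq_left {N N' : Tm Γ (.arr a b)} (M : Tm Γ (.arr b c)) (h : Eqn N N') :
    Eqn (seq N M) (seq N' M) := seq_congr h (refl M)

theorem seq_right (N : Tm Γ (.arr a b)) {M M' : Tm Γ (.arr b c)} (h : Eqn M M') :
    Eqn (seq N M) (seq N M') := seq_congr (refl N) h

theorem beta_var (x : Var Γ q) (M : Tm (q :: Γ) (.arr s t)) :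
    Eqn (push (var x) (pop M)) (M.rename (Ren.cons x (Ren.id Γ))) := by
  have e : (Sub.single (var x) : Sub (q :: Γ) Γ) =
      fun _ y => var (Ren.cons x (Ren.id Γ) y) := by
    funext t y
    cases y <;> rfl
  have h := Eqn.beta (var x) M
  rwa [e, subst_var] at h

/-- A vector abstraction applied to variables. -/
theorem beta_vec : {Γ : Ctx S} → (s : Stk S) → (xs : Ren s Γ) →
    (M : Tm (Ctx.ext Γ s) (.arr a b)) →
    Eqn (pushVec s xs (popVec s M)) (M.rename (Ren.inst s xs (Ren.id Γ)))
  | _, [], _, M => of_eq (rename_id M).symm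
  | Γ, q :: s, xs, M => by
    -- The top variable is pushed last, so its redex is innermost and is contracted first.
    -- Separating it from the other variables `ys` leaves a shorter instance for the recursion.
    have key : ∀ (x : Var Γ q) (ys : Ren s Γ) (M : Tm (Ctx.ext (q :: Γ) s) (.arr a b)),
        Eqn (pushVec s ys (push (var x) (pop (popVec s M))))
          (M.rename (Ren.inst s ys (Ren.cons x (Ren.id Γ)))) := by
      intro x ys M
      refine (pushVec_congr s ys (beta_var x _)).trans ?_
      rw [rename_popVec]
      refine (beta_vec s ys _).trans (of_eq ?_)
      rw [rename_rename, Ren.liftVec_trans_inst, Ren.trans_id]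
    exact key _ _ M

/-- At base type this is a law. At arrow type it is `eta_arr` for the identity, whose closure body
contracts by `beta` to the bound variable itself. -/
theorem eta_one (q : Ty S) : Eqn (nil : Tm Γ (.arr [q] [q])) (pop (push (var .zero) nil)) := by
  cases q with
  | base α => exact eta_base α
  | arr s t =>
    refine (eta_arr nil).trans (pop_congr (push_congr ?_ (refl _)))
    refine (Eqn.beta (var .zero) _).trans (of_eq ?_)
    exact seq_nil (var .zero)

/-- `eta_one` composed with `K`: both composites unfold by definition to the two sides. -/
theorem eta_pop (K : Tm Γ (.arr (q :: a) b)) : Eqn (pop (push (var .zero) (K.wk q))) K :=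
  (comp_congr (a := [q]) (b := [q]) a (eta_one q) (refl K)).symm

/-- Every term is a vector abstraction. -/
theorem eta_vec : {Γ : Ctx S} → {a : Stk S} → (s : Stk S) → (K : Tm Γ (.arr (s ++ a) b)) →
    Eqn (popVec s (pushVec s (Ren.bound s) (K.wkVec s))) K
  | _, _, [], K => of_eq (rename_id K)
  | Γ, a, q :: s, K => by
    refine Eqn.trans (pop_congr ?_) (eta_pop K)
    -- The recursion is applied to the term that first pushes the top variable back; `eta_pop` then
    -- removes that variable.
    refine Eqn.trans (of_eq ?_) (eta_vec (a := a) s (push (var .zero) (K.wk q)))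
    have e : (push (var .zero) (K.wk q)).wkVec s =
        push (var (Ren.wkVec s .zero)) (K.rename ((Ren.wk q).trans (Ren.wkVec s))) := by
      rw [wkVec, rename_push, rename_var, wk, rename_rename]
    exact congrArg (fun L => popVec s (pushVec s (Ren.bound s) L)) e.symm

theorem eta_all (s : Stk S) (K : Tm Γ (.arr s b)) :
    Eqn (popAll s (pushAll s (Ren.bound s) (K.wkVec s))) K := by
  have h := recast_congr (List.append_nil s) (eta_vec s (recast (List.append_nil s).symm K))
  rw [wkVec, rename_recast] at h
  refine h.trans (of_eq ?_)
  have key : ∀ (x : Stk S) (h : x = s), recast h (recast h.symm K) = K := by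
    intro x h; subst h; rfl
  exact key _ _

/-- Function extensionality for terms: by `eta_all` a term is the abstraction of its application to
fresh variables. Equations for arbitrary inputs are thereby reduced to ones about terms without
input. -/
theorem ext_vec {M N : Tm Γ (.arr s b)}
    (h : Eqn (seq (vec s (Ren.bound s)) (M.wkVec s)) (seq (vec s (Ren.bound s)) (N.wkVec s))) :
    Eqn M N := by
  rw [seq_vec, seq_vec] at h
  exact (eta_all s M).symm.trans ((popAll_congr s h).trans (eta_all s N))

end Eqn

-- Terms without input, and the Cartesian closed operations in an arbitrary context.

namespace Tm

/-- Composition `P;K` of a term `P` without input with a term that takes the output of `P` and a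
stack below it. -/
def feed (P : Tm Γ (.arr [] b)) (K : Tm Γ (.arr (b ++ a) c)) : Tm Γ (.arr a c) := comp a P K

/-- The outputs of `P` and of `Q`, with that of `Q` on top. -/
def tens (P : Tm Γ (.arr [] a)) (Q : Tm Γ (.arr [] b)) : Tm Γ (.arr [] (b ++ a)) :=
  seq P (feed Q nil)

theorem seq_feed (P : Tm Γ (.arr [] b)) (K : Tm Γ (.arr (b ++ a) c)) (L : Tm Γ (.arr c d)) :
    seq (feed P K) L = feed P (seq K L) := seq_comp P K L

theorem feed_seq (P : Tm Γ (.arr [] b)) (M : Tm Γ (.arr b c)) (K : Tm Γ (.arr (c ++ a) d)) :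
    feed (seq P M) K = feed P (comp a M K) := comp_seq P M K

theorem feed_vec (s : Stk S) (xs : Ren s Γ) (M : Tm Γ (.arr (s ++ a) b)) :
    feed (vec s xs) M = pushVec s xs M := comp_vec s xs M

theorem feed_recast (P : Tm Γ (.arr [] b)) (K : Tm Γ (.arr b c)) :
    feed (a := []) P (recast (List.append_nil b).symm K) = seq P K := by
  have key : ∀ (x : Stk S) (h : b = x) (h₁ : x = b ++ []) (h₂ : b = b ++ [])
      (h₃ : [] = [] ++ ([] : Stk S)),
      P.compAux (t := []) rfl h₁ h₃ (recast h K) = P.compAux rfl h₂ h₃ K := by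
    intro x h h₁ h₂ h₃
    subst h; rfl
  exact key _ _ _ _ _

theorem seq_tens (P : Tm Γ (.arr [] a)) (Q : Tm Γ (.arr [] b)) (K : Tm Γ (.arr (b ++ a) c)) :
    seq (tens P Q) K = seq P (feed Q K) := by
  rw [tens, seq_assoc, seq_feed, nil_seq]

theorem seq_pushVec (s : Stk S) (xs : Ren s Γ) (M : Tm Γ (.arr (s ++ a) b)) (K : Tm Γ (.arr b c)) :
    seq (pushVec s xs M) K = pushVec s xs (seq M K) := by
  rw [← feed_vec, seq_feed, feed_vec]

theorem seq_pushAll (s : Stk S) (xs : Ren s Γ) (M : Tm Γ (.arr s b)) (K : Tm Γ (.arr b c)) :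
    seq (pushAll s xs M) K = pushAll s xs (seq M K) := by
  rw [← seq_vec, seq_assoc, seq_vec]

/-- The first projection `⟨x⃖⟩.⟨y⃖⟩.[y⃗]`. -/
def fstTm (Γ : Ctx S) (a b : Stk S) : Tm Γ (.arr (b ++ a) a) :=
  popVec b (popAll a (pushAll a (Ren.bound a) nil))

/-- The second projection `⟨x⃖⟩.⟨y⃖⟩.[x⃗]`. -/
def sndTm (Γ : Ctx S) (a b : Stk S) : Tm Γ (.arr (b ++ a) b) :=
  popVec b (popAll a (pushAll b ((Ren.bound b).trans (Ren.wkVec a)) nil))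

/-- The pairing `⟨x⃖⟩.[x⃗].N.[x⃗].M`. -/
def pairTm (N : Tm Γ (.arr s a)) (M : Tm Γ (.arr s b)) : Tm Γ (.arr s (b ++ a)) :=
  popAll s (pushAll s (Ren.bound s)
    (seq (N.wkVec s) (pushVec s (Ren.bound s) (expand (M.wkVec s) a))))

/-- Evaluation `⟨z⟩.z`. -/
def evalTm (Γ : Ctx S) (a b : Stk S) : Tm Γ (.arr (.arr a b :: a) b) :=
  pop (var .zero)

/-- The currying `⟨x⃖⟩.[[x⃗].M]`. -/
def curryTm (M : Tm Γ (.arr (s ++ a) b)) : Tm Γ (.arr s [.arr a b]) :=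
  popAll s (push (pushVec s (Ren.bound s) (M.wkVec s)) nil)

@[simp] theorem rename_fstTm (ρ : Ren Γ Δ) : (fstTm Γ a b).rename ρ = fstTm Δ a b := by
  simp [fstTm]

@[simp] theorem rename_sndTm (ρ : Ren Γ Δ) : (sndTm Γ a b).rename ρ = sndTm Δ a b := by
  have h : ∀ {Δ : Ctx S} (ρ : Ren (Ctx.ext Γ b) Δ), ((Ren.bound b).trans (Ren.wkVec a)).trans
      (ρ.liftVec a) = ((Ren.bound b).trans ρ).trans (Ren.wkVec a) := by
    intro Δ ρ
    rw [Ren.trans_assoc, Ren.wkVec_trans_liftVec, Ren.trans_assoc]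
  simp [sndTm, h]

@[simp] theorem rename_pairTm (N : Tm Γ (.arr s a)) (M : Tm Γ (.arr s b)) (ρ : Ren Γ Δ) :
    (pairTm N M).rename ρ = pairTm (N.rename ρ) (M.rename ρ) := by
  simp [pairTm, rename_rename]

@[simp] theorem rename_evalTm (ρ : Ren Γ Δ) : (evalTm Γ a b).rename ρ = evalTm Δ a b := by
  simp [evalTm]

@[simp] theorem rename_curryTm (M : Tm Γ (.arr (s ++ a) b)) (ρ : Ren Γ Δ) :
    (curryTm M).rename ρ = curryTm (M.rename ρ) := by
  simp [curryTm, rename_rename]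

end Tm

-- The Cartesian closed equations for terms.

namespace Eqn

theorem feed_congr {P P' : Tm Γ (.arr [] b)} {K K' : Tm Γ (.arr (b ++ a) c)} (h : Eqn P P')
    (h' : Eqn K K') : Eqn (feed P K) (feed P' K') := comp_congr a h h'

theorem tens_congr {P P' : Tm Γ (.arr [] a)} {Q Q' : Tm Γ (.arr [] b)} (h : Eqn P P')
    (h' : Eqn Q Q') : Eqn (tens P Q) (tens P' Q') := seq_congr h (feed_congr h' (refl _))

/-- Extensionality for an input stack in two pieces, in the form to which the laws for `tens` apply.
-/
theorem ext_tens {M N : Tm Γ (.arr (b ++ a) c)}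
    (h : Eqn (seq (tens (vec a (Ren.bound a)) (vec b ((Ren.bound b).trans (Ren.wkVec a))))
      ((M.wkVec b).wkVec a)) (seq (tens (vec a (Ren.bound a))
        (vec b ((Ren.bound b).trans (Ren.wkVec a)))) ((N.wkVec b).wkVec a))) :
    Eqn M N := by
  refine (eta_vec b M).symm.trans (Eqn.trans (popVec_congr b (ext_vec ?_)) (eta_vec b N))
  rw [seq_tens, seq_tens, feed_vec, feed_vec] at h
  simpa only [wkVec, rename_pushVec] using h

/-- With no input, the terminal law reduces `P` followed by the removal of its output to the
identity. -/
theorem feed_terminal (P : Tm Γ (.arr [] s)) (K : Tm Γ (.arr a b)) :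
    Eqn (feed P (popVec s (K.wkVec s))) K := by
  have h : Eqn (feed (seq P (popAll s nil)) K) K := feed_congr (b := []) (terminal P) (refl K)
  rw [feed_seq] at h
  exact (of_eq (congrArg (feed P) (comp_popAll s nil K).symm)).trans h

/-- The interchange law for a `P` without input, where the outer abstraction is empty, continued by
`K`. It moves `P` ahead of `N`, with the output of `P` held in variables meanwhile. -/
theorem feed_interchange (P : Tm Γ (.arr [] t)) (N : Tm Γ (.arr r v))
    (K : Tm Γ (.arr (t ++ v) b)) :
    Eqn (seq N (feed P K))
      (feed P (popVec t (seq (N.wkVec t) (pushVec t (Ren.bound t) (K.wkVec t))))) := by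
  have h : Eqn (seq (N.rename (Ren.id Γ)) (feed (P.rename (Ren.id Γ)) nil))
    (feed P (popVec t (seq (N.wkVec t) (pushVec t (Ren.bound t) nil)))) := interchange P N
  rw [rename_id, rename_id] at h
  have h' := seq_left K h
  rwa [seq_assoc, seq_feed, seq_feed, nil_seq, seq_popVec, seq_assoc, seq_pushVec, nil_seq] at h'

/-- The diagonal law without input: copying the output of `P` is running `P` twice. -/
theorem tens_self (P : Tm Γ (.arr [] t)) :
    Eqn (seq P (popAll t (pushAll t (Ren.bound t) (pushVec t (Ren.bound t) nil)))) (tens P P) := by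
  have h : Eqn (seq P (popAll t (pushAll t (Ren.bound t) (pushVec t (Ren.bound t) nil))))
    (tens (P.rename (Ren.id Γ)) (P.rename (Ren.id Γ))) := diagonal P
  rwa [rename_id] at h

theorem fstTm_eqn : Eqn (fstTm Γ a b) (popVec b nil) := popVec_congr b (eta_all a nil)

theorem tens_fst (P : Tm Γ (.arr [] a)) (Q : Tm Γ (.arr [] b)) :
    Eqn (seq (tens P Q) (fstTm Γ a b)) P := by
  rw [seq_tens]
  refine (seq_right P ((feed_congr (refl Q) fstTm_eqn).trans (feed_terminal Q nil))).trans ?_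
  exact of_eq (seq_nil P)

/-- Interchange of `Q` with the term that discards `a`: the lower stack may be removed before `Q`
runs. -/
theorem feed_snd (Q : Tm Γ (.arr [] b)) :
    Eqn (feed Q (sndTm Γ a b)) (seq (popAll a nil) Q) := by
  have h := feed_interchange Q (popAll a nil) (recast (List.append_nil b).symm nil)
  rw [feed_recast, seq_nil] at h
  refine Eqn.trans (of_eq ?_) h.symm
  simp only [wkVec, rename_recast, rename_popAll, rename_nil, seq_popAll, nil_seq, rename_pushVec]
  rfl

theorem tens_snd (P : Tm Γ (.arr [] a)) (Q : Tm Γ (.arr [] b)) :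
    Eqn (seq (tens P Q) (sndTm Γ a b)) Q := by
  rw [seq_tens]
  refine (seq_right P (feed_snd Q)).trans ?_
  rw [← seq_assoc]
  exact seq_left Q (terminal P)

/-- Pairing runs `P` once and reuses its output, while the right side runs `P` twice. Interchange
brings the two copies of `P` together and the diagonal law merges them. -/
theorem seq_pairTm (P : Tm Γ (.arr [] s)) (N : Tm Γ (.arr s a)) (M : Tm Γ (.arr s b)) :
    Eqn (seq P (pairTm N M)) (tens (seq P N) (seq P M)) := by
  apply Eqn.symm
  rw [tens, seq_assoc, feed_seq]
  -- The second copy of `P` moves ahead of `N`, next to the first.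
  refine (seq_right P (feed_interchange P N _)).trans ?_
  rw [← seq_tens]
  -- The adjacent copies become one copy followed by duplication; the remaining redex on the
  -- duplicated variables is contracted by `beta_vec`.
  refine (seq_left _ (tens_self P).symm).trans ?_
  rw [seq_assoc, seq_popAll, seq_pushAll, seq_pushVec, nil_seq]
  refine seq_right P (popAll_congr s (pushAll_congr s _ ?_))
  rw [wkVec, rename_popVec]
  refine (beta_vec s _ _).trans (of_eq ?_)
  simp [rename_rename, Ren.trans_assoc, expand]

theorem tens_evalTm (P : Tm Γ (.arr [] a)) (N : Tm Γ (.arr a b)) :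
    Eqn (seq (tens P (push N nil)) (evalTm Γ a b)) (seq P N) := by
  rw [seq_tens]
  refine seq_right P ?_
  refine Eqn.trans (beta N (var .zero)) (of_eq ?_)
  exact seq_nil N

/-- Only variables are fed here, so `beta_vec` is enough; extensionality never requires more. -/
theorem vec_curryTm (xs : Ren s Γ) (M : Tm Γ (.arr (s ++ a) b)) :
    Eqn (seq (vec s xs) (curryTm M)) (push (pushVec s xs M) nil) := by
  rw [seq_vec, pushAll, curryTm, popAll]
  have key : ∀ (x : Stk S) (h : x = s) (L : Tm Γ (.arr x [.arr a b])),
    recast h.symm (recast h L) = L := by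
    intro x h L; subst h; rfl
  rw [key]
  refine (beta_vec s xs _).trans (of_eq ?_)
  simp [rename_rename]

theorem pairTm_fst_snd : Eqn (pairTm (fstTm Γ a b) (sndTm Γ a b)) nil := by
  refine ext_tens ?_
  simp only [wkVec, rename_pairTm, rename_fstTm, rename_sndTm, rename_nil, seq_nil]
  exact (seq_pairTm _ _ _).trans (tens_congr (tens_fst _ _) (tens_snd _ _))

theorem pairTm_congr {N N' : Tm Γ (.arr s a)} {M M' : Tm Γ (.arr s b)} (h : Eqn N N')
    (h' : Eqn M M') : Eqn (pairTm N M) (pairTm N' M') :=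
  popAll_congr s (pushAll_congr s _ (seq_congr (h.rename _)
    (pushVec_congr s _ (comp_congr _ (h'.rename _) (refl _)))))

theorem curryTm_congr {M M' : Tm Γ (.arr (s ++ a) b)} (h : Eqn M M') :
    Eqn (curryTm M) (curryTm M') :=
  popAll_congr s (push_congr (pushVec_congr s _ (h.rename _)) (refl _))

theorem pairTm_fst (N : Tm Γ (.arr s a)) (M : Tm Γ (.arr s b)) :
    Eqn (seq (pairTm N M) (fstTm Γ a b)) N := by
  refine ext_vec ?_
  simp only [wkVec, rename_seq, rename_pairTm, rename_fstTm]
  rw [← seq_assoc]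
  exact (seq_left _ (seq_pairTm _ _ _)).trans (tens_fst _ _)

theorem pairTm_snd (N : Tm Γ (.arr s a)) (M : Tm Γ (.arr s b)) :
    Eqn (seq (pairTm N M) (sndTm Γ a b)) M := by
  refine ext_vec ?_
  simp only [wkVec, rename_seq, rename_pairTm, rename_sndTm]
  rw [← seq_assoc]
  exact (seq_left _ (seq_pairTm _ _ _)).trans (tens_snd _ _)

/-- On variables, `seq_pairTm` splits the pairing. Used backwards, with the output of `M` as input,
it yields the pairing of the two projections, which is the identity. -/
theorem pairTm_eta (M : Tm Γ (.arr s (b ++ a))) :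
    Eqn (pairTm (seq M (fstTm Γ a b)) (seq M (sndTm Γ a b))) M := by
  refine ext_vec ?_
  simp only [wkVec, rename_seq, rename_pairTm, rename_fstTm, rename_sndTm]
  refine (seq_pairTm _ _ _).trans ?_
  rw [← seq_assoc, ← seq_assoc]
  refine (seq_pairTm _ _ _).symm.trans ((seq_right _ pairTm_fst_snd).trans ?_)
  exact of_eq (seq_nil _)

/-- The computation shared by the beta and eta laws of exponentials: on a pair of inputs, `M` is
applied to the upper component before evaluation. -/
theorem tens_pairTm_evalTm (P : Tm Γ (.arr [] a)) (Q : Tm Γ (.arr [] s))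
    (M : Tm Γ (.arr s [.arr a b])) :
    Eqn (seq (tens P Q) (seq (pairTm (fstTm Γ a s) (seq (sndTm Γ a s) M)) (evalTm Γ a b)))
      (seq (tens P (seq Q M)) (evalTm Γ a b)) := by
  rw [← seq_assoc]
  refine seq_left _ ((seq_pairTm _ _ _).trans (tens_congr (tens_fst _ _) ?_))
  rw [← seq_assoc]
  exact seq_left M (tens_snd _ _)

theorem curryTm_beta (M : Tm Γ (.arr (s ++ a) b)) :
    Eqn (seq (pairTm (fstTm Γ a s) (seq (sndTm Γ a s) (curryTm M))) (evalTm Γ a b)) M := by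
  refine ext_tens ?_
  simp only [wkVec, rename_seq, rename_pairTm, rename_fstTm, rename_sndTm, rename_curryTm,
    rename_evalTm]
  refine (tens_pairTm_evalTm _ _ _).trans ?_
  refine (seq_left _ (tens_congr (refl _) (vec_curryTm _ _))).trans ((tens_evalTm _ _).trans ?_)
  rw [seq_tens, feed_vec]
  exact refl _

theorem curryTm_eta (M : Tm Γ (.arr s [.arr a b])) :
    Eqn (curryTm (seq (pairTm (fstTm Γ a s) (seq (sndTm Γ a s) M)) (evalTm Γ a b))) M := by
  -- The composite built from projections and pairing is brought to the form of the closure body in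
  -- `eta_arr`, where `M` runs directly on the upper part of the stack.
  have h : Eqn (seq (pairTm (fstTm Γ a s) (seq (sndTm Γ a s) M)) (evalTm Γ a b))
      (comp a M (evalTm Γ a b)) := by
    refine ext_tens ?_
    simp only [wkVec, rename_seq, rename_pairTm, rename_fstTm, rename_sndTm, rename_comp]
    rw [show ∀ {Δ : Ctx S} (ρ : Ren Γ Δ), (evalTm Γ a b).rename ρ = evalTm Δ a b from
      fun ρ => rename_evalTm ρ]
    refine (tens_pairTm_evalTm _ _ _).trans (of_eq ?_)
    rw [seq_tens, seq_tens, feed_seq]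
    rfl
  refine (curryTm_congr h).trans (Eqn.trans (of_eq ?_) (eta_arr M).symm)
  rw [curryTm, wkVec, rename_comp]
  rfl

end Eqn

/-- The interpretation respects the equations of Cartesian closed categories. -/
theorem interpSound (S : Type u) : InterpSound S := by
  intro A B f g h
  induction h with
  | refl f => exact .refl _
  | symm _ ih => exact ih.symm
  | trans _ _ ih₁ ih₂ => exact ih₁.trans ih₂
  | comp_congr _ _ ih₁ ih₂ => exact Eqn.seq_congr ih₁ ih₂
  | pair_congr _ _ ih₁ ih₂ => exact Eqn.pairTm_congr ih₁ ih₂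
  | @curry_congr A X B _ _ _ ih =>
    exact Eqn.curryTm_congr (s := interpObj X) (a := interpObj A) ih
  | id_comp f => exact .refl _
  | comp_id f => exact .of_eq (seq_nil _)
  | assoc f g h => exact .of_eq (seq_assoc _ _ _)
  -- With an empty output stack, the abstraction in the terminal law is the identity `nil`.
  | bang_uniq f => exact (Eqn.of_eq (seq_nil (interp f)).symm).trans (Eqn.terminal (interp f))
  | pair_fst f g => exact Eqn.pairTm_fst _ _
  | pair_snd f g => exact Eqn.pairTm_snd _ _
  | @pair_eta X A B h => exact Eqn.pairTm_eta (a := interpObj A) (b := interpObj B) (interp h)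
  | @curry_beta A X B f =>
    exact Eqn.curryTm_beta (s := interpObj X) (a := interpObj A) (interp f)
  | curry_eta g => exact Eqn.curryTm_eta (interp g)

end FMC

theorem mainTheorem2 (S : Type u) :
    ∃ h : FMC.InterpSound S, (FMC.interpFunctor S h).Faithful := by
  refine ⟨FMC.interpSound S, ⟨fun {A B f g} h => ?_⟩⟩
  induction f using Quotient.inductionOn
  induction g using Quotient.inductionOn
  exact FMC.interp_faithful _ _ (Quotient.exact h)
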